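/- Let $d\ge 1$ and let $(\Omega,\mathcal A,P)$ be a probability space carrying independent and identically distributed pairs $(I_t,\varepsilon_t)$, $t=1,2,\dots$, with values in $\mathbb R^d\times\mathbb R$. Let $f\colon[0,1]^d\to\mathbb R$ be isotonic (non-decreasing in each argument) and let $Y_t=f(I_t)+\varepsilon_t$. Assume: (i) $I_t$ has a Lebesgue density $p$ on $[0,1]^d$ with $C_1:=\inf_{[0,1]^d}p>0$ and $C_2:=\sup_{[0,1]^d}p<\infty$; (ii) $E(\varepsilon_t\mid I_t)=0$ a.s. and $E(\varepsilon_t^2\mid I_t)\le\overline\sigma_\varepsilon^2$ a.s., for some constant $\overline\sigma_\varepsilon^2<\infty$. Write $\preceq$ for the componentwise order on $\mathbb R^d$ and $[a,b]=[a_1,b_1]\times\cdots\times[a_d,b_d]$. Let $\mathrm{Av}_Y(B)$ be the average of those $Y_t$, $t\le n$, with $I_t\in B$; if there is no such $t$, then $\mathrm{Av}_Y(B):=c$ for an arbitrary fixed real number $c$. For $x\in[0,1]^d$ put $$\underline f_n(x)=\max_{a\preceq x}\,\min_{b\succeq x}\mathrm{Av}_Y([a,b]),\qquad \overline f_n(x)=\min_{b\succeq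 x}\,\max_{a\preceq x}\mathrm{Av}_Y([a,b]),$$ where $a,b$ range over $[0,1]^d$, and let $\widehat f_n$ be any isotonic estimator with $\underline f_n(x)\le\widehat f_n(x)\le\overline f_n(x)$ for all $x\in[0,1]^d$. Let $M_n=\lfloor n^{1/(d+2)}\rfloor$, $h_n=1/M_n$, $D_n=[h_n,1-h_n]^d$, and, for $k\in\{1,\dots,M_n\}^d$, let $B_k=\prod_{i=1}^d((k_i-1)h_n,k_ih_n]$. Let $$A_n=\left\{\#\{t\le n\colon I_t\in B_k\}\ge (C_1/2)\,n^{2/(d+2)}\ \text{ for all } k\in\{1,\dots,M_n\}^d\right\}.$$ Then, with $\lambda^d$ the Lebesgue measure on $\mathbb R^d$, $$E\left[\int_{D_n}\bigl|\widehat f_n(x)-f(x)\bigr|\,\lambda^d(dx)\ \mathbf 1_{A_n}\right]=O\bigl(n^{-1/(d+2)}\bigr)\qquad(n\to\infty).$$ -/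

import Mathlib

open MeasureTheory ProbabilityTheory Filter
open scoped ENNReal NNReal

noncomputable section

namespace IsoReg

/-- The unit cube `[0,1]^d`.  The order on `Fin d → ℝ` is the componentwise one. -/
def cube (d : ℕ) : Set (Fin d → ℝ) := Set.Icc 0 1

/-- The number of observations among the first `n` design points `u 0, …, u (n-1)`
that lie in `B`. -/
def count {d : ℕ} (n : ℕ) (u : ℕ → Fin d → ℝ) (B : Set (Fin d → ℝ)) : ℕ :=
  {t : ℕ | t < n ∧ u t ∈ B}.ncard

open Classical in
/-- The average of the responses `y t`, `t < n`, over those `t` with `u t ∈ B`.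
If `B` contains no design point, the average is assigned the value `c`
(a fixed convention for the meaningless quotient `0 / 0`). -/
def avg {d : ℕ} (n : ℕ) (u : ℕ → Fin d → ℝ) (y : ℕ → ℝ) (c : ℝ) (B : Set (Fin d → ℝ)) : ℝ :=
  if count n u B = 0 then c
  else (∑ t ∈ Finset.range n, if u t ∈ B then y t else 0) / (count n u B : ℝ)

/-- The max–min estimator over hyperrectangles,
`max_{a ⪯ x} min_{b ⪰ x} Av_Y [a,b]` with `a, b ∈ [0,1]^d`.  For fixed data the averages
take finitely many values, so for `x ∈ [0,1]^d` supremum and infimum are attained. -/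
def lowerEst {d : ℕ} (n : ℕ) (u : ℕ → Fin d → ℝ) (y : ℕ → ℝ) (c : ℝ) (x : Fin d → ℝ) : ℝ :=
  ⨆ a : Set.Icc (0 : Fin d → ℝ) x, ⨅ b : Set.Icc x (1 : Fin d → ℝ),
    avg n u y c (Set.Icc (a : Fin d → ℝ) (b : Fin d → ℝ))

/-- The min–max estimator over hyperrectangles,
`min_{b ⪰ x} max_{a ⪯ x} Av_Y [a,b]` with `a, b ∈ [0,1]^d`. -/
def upperEst {d : ℕ} (n : ℕ) (u : ℕ → Fin d → ℝ) (y : ℕ → ℝ) (c : ℝ) (x : Fin d → ℝ) : ℝ :=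
  ⨅ b : Set.Icc x (1 : Fin d → ℝ), ⨆ a : Set.Icc (0 : Fin d → ℝ) x,
    avg n u y c (Set.Icc (a : Fin d → ℝ) (b : Fin d → ℝ))

/-- `M_n = ⌊n^{1/(d+2)}⌋`. -/
def gridSize (d n : ℕ) : ℕ := ⌊(n : ℝ) ^ ((1 : ℝ) / ((d : ℝ) + 2))⌋₊

/-- `h_n = 1 / M_n`. -/
def meshWidth (d n : ℕ) : ℝ := 1 / (gridSize d n : ℝ)

/-- The cell `B_k = ∏_i ((k_i - 1) h_n, k_i h_n]`. -/
def cell (d n : ℕ) (k : Fin d → ℕ) : Set (Fin d → ℝ) :=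
  Set.pi Set.univ fun i =>
    Set.Ioc (((k i : ℝ) - 1) * meshWidth d n) ((k i : ℝ) * meshWidth d n)

/-- The event `A_n` that every cell `B_k`, `1 ≤ k_i ≤ M_n`, contains at least
`(C₁ / 2) n^{2/(d+2)}` of the first `n` design points. -/
def regularEvent {Ω : Type*} {d : ℕ} (I : ℕ → Ω → Fin d → ℝ) (C₁ : ℝ) (n : ℕ) : Set Ω :=
  {ω | ∀ k : Fin d → ℕ, (∀ i, 1 ≤ k i ∧ k i ≤ gridSize d n) →
    C₁ / 2 * (n : ℝ) ^ ((2 : ℝ) / ((d : ℝ) + 2)) ≤ (count n (fun t => I t ω) (cell d n k) : ℝ)}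

/-- The interior box `D_n = [h_n, 1 - h_n]^d`. -/
def interiorBox (d n : ℕ) : Set (Fin d → ℝ) :=
  Set.Icc (fun _ => meshWidth d n) (fun _ => 1 - meshWidth d n)

end IsoReg

end

/-! Cover `interiorBox` by closed mesh cells `[(k+1)h, (k+2)h]`. For `x` in such a cell, insert `b =
(k+3)h` into the min–max estimator. Monotonicity of `f` bounds the estimator by `f b` plus the
largest error average over boxes `[a, b]` with `a ≤ x`. Symmetrically, `a = kh` bounds the max–min
estimator from below. Hence the loss on the cell is at most `f ((k+3)h) - f (kh)` plus noise
(`upperEst_le_add`, `sub_le_lowerEst`).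

Bias: summed over `k`, the differences cancel except in a boundary layer of order `M^(d-1)` lattice
points (`sum_shift_sub_le`). The factor `h^d` turns this into `O(h)`.

Noise: the boxes have one fixed grid corner and all sides at least `h`. Sort them by dyadic side
lengths `2^(J i) h`. On the regular event such a box contains at least `L ∏ 2^(J i)` design points,
with `L` the guaranteed cell count. A multiparameter maximal inequality bounds the expected maximal
squared error sum at scale `J` by a constant times `n h^d ∏ 2^(J i)`. Division by `L^2 ∏ 4^(J i)`
leaves a geometric series over the scales, so the maximal squared average has mean `O(n h^d / L^2) =
O(h^2)` (`exists_signedBox_majorant`). The bound `|z| ≤ δ + z^2 / δ` with `δ = n^(-1/(d+2))` passes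
to first moments.

The maximal inequality (`integral_sq_norm_orthant_le`) comes from Doob's inequality by induction on
the dimension: one coordinate plays the role of time, and the thresholds in the others index a sup
norm. The design is random, so the probability space is partitioned by the orderings of the design
coordinates. The errors stay centered on each piece (`isCentered_map_restrict`), and the pieces
recombine without loss (`exists_orthant_majorant`). -/

namespace IsoReg

/-! ### Doob's maximal inequality for sup norms of partial sums -/

/-- A pathwise form of Doob's `L²` maximal inequality. -/
theorem sq_partialSups_le (s : ℕ → ℝ) (h0 : s 0 = 0) (n : ℕ) :
    (partialSups s n) ^ 2 ≤
      4 * s n ^ 2 - 4 * ∑ k ∈ Finset.range n, partialSups s k * (s (k + 1) - s k) := by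
  -- The mixed term `s n * partialSups s n` makes the induction close: equality is preserved when
  -- the maximum does not move, and a square is gained when it does. It is split by Young's
  -- inequality only at the end.
  have key : ∀ n, (partialSups s n) ^ 2 ≤ 2 * s n * partialSups s n -
      2 * ∑ k ∈ Finset.range n, partialSups s k * (s (k + 1) - s k) := by
    intro n
    induction n with
    | zero => simp [h0]
    | succ n ih =>
      rw [Finset.sum_range_succ]
      have hsucc : partialSups s (n + 1) = partialSups s n ⊔ s (n + 1) := partialSups_add_one s n
      rcases le_total (s (n + 1)) (partialSups s n) with h | h
      · rw [hsucc, sup_eq_left.mpr h]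
        linarith
      · rw [hsucc, sup_eq_right.mpr h]
        nlinarith [sq_nonneg (s (n + 1) - partialSups s n)]
  nlinarith [key n, sq_nonneg (2 * s n - partialSups s n)]

variable {ι J : Type*} [Fintype ι] [Fintype J]

/-- Each coordinate of `ν` is conditionally centered given all the other coordinates. -/
def IsCentered {ι : Type*} [DecidableEq ι] (ν : Measure (ι → ℝ)) : Prop :=
  ∀ (t : ι) (φ : (ι → ℝ) → ℝ), Measurable φ → (∀ x r, φ (Function.update x t r) = φ x) →
    Integrable (fun x => x t * φ x) ν → ∫ x, x t * φ x ∂ν = 0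

/-- The average, over the coordinates where `|S j|` is maximal, of the subgradients
`sign (S j) * w j` of the sup norm. -/
noncomputable def supSubgradient (w S : J → ℝ) : ℝ :=
  (∑ j, if |S j| = ‖S‖ then (if 0 ≤ S j then w j else -w j) else 0) /
    (∑ j, if |S j| = ‖S‖ then 1 else 0)

/-- Averaging over all maximizing coordinates, instead of selecting one, avoids a measurable
selection. -/
theorem measurable_supSubgradient (w : J → ℝ) : Measurable (supSubgradient w) := by
  unfold supSubgradient
  have hm : ∀ j : J, MeasurableSet {S : J → ℝ | |S j| = ‖S‖} := fun j =>
    measurableSet_eq_fun (measurable_pi_apply j).abs measurable_norm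
  refine Measurable.div (Finset.measurable_sum _ fun j _ => ?_)
    (Finset.measurable_sum _ fun j _ => ?_)
  · refine Measurable.ite (hm j) (Measurable.ite ?_ measurable_const measurable_const)
      measurable_const
    exact measurableSet_le measurable_const (measurable_pi_apply j)
  · exact Measurable.ite (hm j) measurable_const measurable_const

theorem sum_argmax_pos [Nonempty J] (S : J → ℝ) :
    (0 : ℝ) < ∑ j, if |S j| = ‖S‖ then 1 else 0 := by
  obtain ⟨j, hj⟩ : ∃ j, |S j| = ‖S‖ := by
    obtain ⟨j, -, hj⟩ := Finset.exists_max_image Finset.univ (fun j => |S j|) Finset.univ_nonempty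
    refine ⟨j, le_antisymm (norm_le_pi_norm S j) ?_⟩
    exact (pi_norm_le_iff_of_nonneg (abs_nonneg _)).2 fun i => hj i (Finset.mem_univ i)
  refine Finset.sum_pos' (fun i _ => by split_ifs <;> norm_num) ⟨j, Finset.mem_univ j, ?_⟩
  simp [hj]

/-- Every maximizing coordinate satisfies this inequality with its own signed slope, and an average
of such inequalities is again one. It replaces conditional Jensen in the submartingale property. -/
theorem norm_add_mul_supSubgradient_le [Nonempty J] (w S : J → ℝ) (r : ℝ) :
    ‖S‖ + r * supSubgradient w S ≤ ‖S + r • w‖ := by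
  have hpos := sum_argmax_pos S
  unfold supSubgradient
  rw [← sub_nonneg]
  have : ‖S + r • w‖ - (‖S‖ + r * ((∑ j, if |S j| = ‖S‖ then (if 0 ≤ S j then w j else -w j)
      else 0) / (∑ j, if |S j| = ‖S‖ then 1 else 0))) =
      (∑ j, if |S j| = ‖S‖ then
        (‖S + r • w‖ - (‖S‖ + r * (if 0 ≤ S j then w j else -w j))) else 0) /
        (∑ j, if |S j| = ‖S‖ then 1 else 0) := by
    rw [eq_div_iff hpos.ne', sub_mul, add_mul, mul_assoc, div_mul_cancel₀ _ hpos.ne',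
      Finset.mul_sum, Finset.mul_sum, Finset.mul_sum, ← Finset.sum_add_distrib,
      ← Finset.sum_sub_distrib]
    refine Finset.sum_congr rfl fun j _ => ?_
    split_ifs <;> ring
  rw [this]
  refine div_nonneg (Finset.sum_nonneg fun j _ => ?_) hpos.le
  split_ifs with h1 h2
  · have := (le_abs_self _).trans (norm_le_pi_norm (S + r • w) j)
    simp only [Pi.add_apply, Pi.smul_apply, smul_eq_mul] at this
    rw [← h1, abs_of_nonneg h2]; linarith
  · have := (neg_le_abs _).trans (norm_le_pi_norm (S + r • w) j)
    simp only [Pi.add_apply, Pi.smul_apply, smul_eq_mul] at this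
    rw [← h1, abs_of_neg (not_le.1 h2)]; linarith
  · exact le_rfl

theorem abs_supSubgradient_le [Nonempty J] (w S : J → ℝ) : |supSubgradient w S| ≤ ‖w‖ := by
  have hpos := sum_argmax_pos S
  unfold supSubgradient
  rw [abs_div, abs_of_pos hpos, div_le_iff₀ hpos, Finset.mul_sum]
  refine (Finset.abs_sum_le_sum_abs _ _).trans (Finset.sum_le_sum fun j _ => ?_)
  have := norm_le_pi_norm w j
  rw [Real.norm_eq_abs] at this
  split_ifs <;> simp [this]

/-- Cauchy–Schwarz. The integrands in the maximal inequalities grow at most quadratically, so this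
settles their integrability. -/
theorem integrable_of_le_sq_sum {ν : Measure (ι → ℝ)} (hL2 : ∀ t, Integrable (fun x => x t ^ 2) ν)
    {g : (ι → ℝ) → ℝ} (hg : Measurable g) (h : ∀ x, |g x| ≤ (∑ t, |x t|) ^ 2) :
    Integrable g ν := by
  have : Integrable (fun x : ι → ℝ => (Fintype.card ι : ℝ) * ∑ t, x t ^ 2) ν :=
    (integrable_finsetSum _ fun t _ => hL2 t).const_mul _
  refine this.mono' hg.aestronglyMeasurable (.of_forall fun x => (h x).trans ?_)
  have := sq_sum_le_card_mul_sum_sq (s := Finset.univ) (f := fun t => |x t|)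
  simpa using this

/-- Adaptedness without a filtration: a prefix sum does not see coordinates of later rank. -/
theorem sum_smul_update_of_le {ι J : Type*} [Fintype ι] [DecidableEq ι] (v : ι → J → ℝ)
    (ρ : ι → ℕ) {k : ℕ} {t : ι} (ht : k ≤ ρ t) (x : ι → ℝ) (r : ℝ) :
    ∑ s with ρ s < k, Function.update x t r s • v s = ∑ s with ρ s < k, x s • v s := by
  refine Finset.sum_congr rfl fun s hs => ?_
  have : s ≠ t := by
    rintro rfl
    exact absurd (Finset.mem_filter.1 hs).2 (not_lt.2 ht)
  rw [Function.update_of_ne this]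

/-- The norm of the partial sum over the indices of rank less than `k`. -/
noncomputable def prefixNorm (v : ι → J → ℝ) (ρ : ι → ℕ) (k : ℕ) (x : ι → ℝ) : ℝ :=
  ‖∑ t with ρ t < k, x t • v t‖

section prefixNorm

variable (v : ι → J → ℝ) (ρ : ι → ℕ)

theorem continuous_prefixNorm (k : ℕ) : Continuous (prefixNorm v ρ k) := by
  unfold prefixNorm; fun_prop

theorem prefixNorm_nonneg (k : ℕ) (x : ι → ℝ) : 0 ≤ prefixNorm v ρ k x := norm_nonneg _

theorem prefixNorm_le (hv : ∀ t, ‖v t‖ ≤ 1) (k : ℕ) (x : ι → ℝ) :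
    prefixNorm v ρ k x ≤ ∑ t, |x t| := by
  unfold prefixNorm
  refine (norm_sum_le _ _).trans ?_
  refine (Finset.sum_le_sum fun t _ => ?_).trans (Finset.sum_le_sum_of_subset_of_nonneg
    (Finset.filter_subset _ _) fun t _ _ => abs_nonneg (x t))
  rw [norm_smul, Real.norm_eq_abs]
  exact mul_le_of_le_one_right (abs_nonneg _) (hv t)

theorem measurable_partialSups_prefixNorm (k : ℕ) :
    Measurable fun x => partialSups (fun l => prefixNorm v ρ l x) k := by
  induction k with
  | zero => simpa using (continuous_prefixNorm v ρ 0).measurable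
  | succ k ih =>
    simp only [partialSups_add_one]
    exact ih.sup (continuous_prefixNorm v ρ (k + 1)).measurable

theorem partialSups_prefixNorm_nonneg (k : ℕ) (x : ι → ℝ) :
    0 ≤ partialSups (fun l => prefixNorm v ρ l x) k :=
  (prefixNorm_nonneg v ρ k x).trans (le_partialSups (fun l => prefixNorm v ρ l x) k)

theorem partialSups_prefixNorm_le (hv : ∀ t, ‖v t‖ ≤ 1) (k : ℕ) (x : ι → ℝ) :
    partialSups (fun l => prefixNorm v ρ l x) k ≤ ∑ t, |x t| :=
  partialSups_le _ _ _ fun l _ => prefixNorm_le v ρ hv l x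

/-- The submartingale property, tested against the running maximum. Injectivity of `ρ` means that at
most one term `x t • v t` enters. The subgradient bounds the increment below by `x t` times a
function of earlier coordinates, which integrates to zero by centering. -/
theorem integral_increment_nonneg [DecidableEq ι] [Nonempty J] {ν : Measure (ι → ℝ)} (hν : IsCentered ν)
    (hL2 : ∀ t, Integrable (fun x => x t ^ 2) ν) (hv : ∀ t, ‖v t‖ ≤ 1)
    (hρ : Function.Injective ρ) (k : ℕ) :
    0 ≤ ∫ x, partialSups (fun l => prefixNorm v ρ l x) k *
      (prefixNorm v ρ (k + 1) x - prefixNorm v ρ k x) ∂ν := by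
  by_cases hk : ∃ t, ρ t = k
  · obtain ⟨t, rfl⟩ := hk
    set m : (ι → ℝ) → ℝ := fun x => partialSups (fun l => prefixNorm v ρ l x) (ρ t) with hm
    have hm_meas : Measurable m := measurable_partialSups_prefixNorm v ρ _
    have hm0 : ∀ x, 0 ≤ m x := partialSups_prefixNorm_nonneg v ρ _
    have hmle : ∀ x, m x ≤ ∑ t, |x t| := partialSups_prefixNorm_le v ρ hv _
    set S : (ι → ℝ) → J → ℝ := fun x => ∑ s with ρ s < ρ t, x s • v s with hS
    have hS_meas : Measurable S := by
      have : Continuous S := by simp only [hS]; fun_prop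
      exact this.measurable
    set φ : (ι → ℝ) → ℝ := fun x => m x * supSubgradient (v t) (S x) with hφ
    have hφ_meas : Measurable φ :=
      hm_meas.mul ((measurable_supSubgradient (v t)).comp hS_meas)
    have hstep : ∀ x, prefixNorm v ρ (ρ t + 1) x = ‖S x + x t • v t‖ := by
      intro x
      have hfil : (Finset.univ.filter fun s => ρ s < ρ t + 1) =
          insert t (Finset.univ.filter fun s => ρ s < ρ t) := by
        ext s
        simp only [Finset.mem_filter, Finset.mem_univ, true_and, Finset.mem_insert,
          Nat.lt_succ_iff, le_iff_lt_or_eq, hρ.eq_iff]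
        tauto
      unfold prefixNorm
      rw [hfil, Finset.sum_insert (by simp), add_comm]
    have hφ_le : ∀ x, |x t * φ x| ≤ (∑ t, |x t|) ^ 2 := by
      intro x
      have h1 : |x t| ≤ ∑ t, |x t| :=
        Finset.single_le_sum (f := fun t => |x t|) (fun s _ => abs_nonneg _) (Finset.mem_univ t)
      have h2 := (abs_supSubgradient_le (v t) (S x)).trans (hv t)
      rw [hφ, abs_mul, abs_mul, abs_of_nonneg (hm0 x), sq]
      refine mul_le_mul h1 ?_ (mul_nonneg (hm0 x) (abs_nonneg _)) ((abs_nonneg _).trans h1)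
      exact (mul_le_of_le_one_right (hm0 x) h2).trans (hmle x)
    have hφ_int : Integrable (fun x => x t * φ x) ν :=
      integrable_of_le_sq_sum hL2 ((measurable_pi_apply t).mul hφ_meas) hφ_le
    have hzero := hν t φ hφ_meas (fun x r => by
      have h1 : S (Function.update x t r) = S x := sum_smul_update_of_le v ρ le_rfl x r
      have h2 : m (Function.update x t r) = m x := by
        simp only [hm]
        refine le_antisymm (partialSups_le _ _ _ fun l hl => ?_)
          (partialSups_le _ _ _ fun l hl => ?_)
        · refine le_trans (le_of_eq ?_) (le_partialSups_of_le _ hl)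
          unfold prefixNorm; rw [sum_smul_update_of_le v ρ hl]
        · refine le_trans (le_of_eq ?_) (le_partialSups_of_le _ hl)
          unfold prefixNorm; rw [sum_smul_update_of_le v ρ hl]
      simp only [hφ, h1, h2]) hφ_int
    rw [← hzero]
    refine integral_mono hφ_int ?_ fun x => ?_
    · refine integrable_of_le_sq_sum hL2 (hm_meas.mul
        ((continuous_prefixNorm v ρ _).measurable.sub (continuous_prefixNorm v ρ _).measurable))
        fun x => ?_
      rw [abs_mul, abs_of_nonneg (hm0 x), sq]
      refine mul_le_mul (hmle x) ?_ (abs_nonneg _) ((hm0 x).trans (hmle x))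
      have h1 := prefixNorm_le v ρ hv (ρ t + 1) x
      have h2 := prefixNorm_le v ρ hv (ρ t) x
      have h3 := prefixNorm_nonneg v ρ (ρ t + 1) x
      have h4 := prefixNorm_nonneg v ρ (ρ t) x
      rw [abs_le]; constructor <;> linarith
    · have h := norm_add_mul_supSubgradient_le (v t) (S x) (x t)
      rw [← hstep x] at h
      have h' : prefixNorm v ρ (ρ t) x = ‖S x‖ := rfl
      calc x t * φ x = m x * (x t * supSubgradient (v t) (S x)) := by simp only [hφ]; ring
        _ ≤ _ := mul_le_mul_of_nonneg_left (by rw [h']; linarith) (hm0 x)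
  · have hfil : ∀ x, prefixNorm v ρ (k + 1) x = prefixNorm v ρ k x := by
      intro x
      unfold prefixNorm
      congr 2
      ext s
      simp only [Finset.mem_filter, Finset.mem_univ, true_and]
      have : ρ s ≠ k := fun h => hk ⟨s, h⟩
      omega
    simp [hfil]

/-- Doob's `L²` maximal inequality for the norms of partial sums. -/
theorem integral_sq_partialSups_le [DecidableEq ι] [Nonempty J] {ν : Measure (ι → ℝ)} (hν : IsCentered ν)
    (hL2 : ∀ t, Integrable (fun x => x t ^ 2) ν) (hv : ∀ t, ‖v t‖ ≤ 1)
    (hρ : Function.Injective ρ) (k : ℕ) :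
    ∫ x, (partialSups (fun l => prefixNorm v ρ l x) k) ^ 2 ∂ν ≤
      4 * ∫ x, prefixNorm v ρ k x ^ 2 ∂ν := by
  have hsq : ∀ {g : (ι → ℝ) → ℝ}, Measurable g → (∀ x, 0 ≤ g x) → (∀ x, g x ≤ ∑ t, |x t|) →
      Integrable (fun x => g x ^ 2) ν := fun hg h0 hle =>
    integrable_of_le_sq_sum hL2 (hg.pow_const 2) fun x => by
      rw [abs_of_nonneg (sq_nonneg _)]
      exact pow_le_pow_left₀ (h0 x) (hle x) 2
  have hN := hsq (continuous_prefixNorm v ρ k).measurable (prefixNorm_nonneg v ρ k)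
    (prefixNorm_le v ρ hv k)
  have hI : ∀ l, Integrable (fun x => partialSups (fun l => prefixNorm v ρ l x) l *
      (prefixNorm v ρ (l + 1) x - prefixNorm v ρ l x)) ν := by
    intro l
    refine integrable_of_le_sq_sum hL2 ((measurable_partialSups_prefixNorm v ρ l).mul
      ((continuous_prefixNorm v ρ _).measurable.sub (continuous_prefixNorm v ρ _).measurable))
      fun x => ?_
    have h0 := partialSups_prefixNorm_nonneg v ρ l x
    have h5 := partialSups_prefixNorm_le v ρ hv l x
    rw [abs_mul, abs_of_nonneg h0, sq]
    refine mul_le_mul h5 ?_ (abs_nonneg _) (h0.trans h5)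
    have h1 := prefixNorm_le v ρ hv (l + 1) x
    have h2 := prefixNorm_le v ρ hv l x
    have h3 := prefixNorm_nonneg v ρ (l + 1) x
    have h4 := prefixNorm_nonneg v ρ l x
    rw [abs_le]; constructor <;> linarith
  calc ∫ x, (partialSups (fun l => prefixNorm v ρ l x) k) ^ 2 ∂ν
      ≤ ∫ x, (4 * prefixNorm v ρ k x ^ 2 - 4 * ∑ l ∈ Finset.range k,
          partialSups (fun l => prefixNorm v ρ l x) l *
            (prefixNorm v ρ (l + 1) x - prefixNorm v ρ l x)) ∂ν := by
        refine integral_mono (hsq (measurable_partialSups_prefixNorm v ρ k)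
          (partialSups_prefixNorm_nonneg v ρ k) (partialSups_prefixNorm_le v ρ hv k))
          ((hN.const_mul 4).sub ((integrable_finsetSum _ fun l _ => hI l).const_mul 4)) fun x => ?_
        exact sq_partialSups_le _ (by simp [prefixNorm]) k
    _ = 4 * ∫ x, prefixNorm v ρ k x ^ 2 ∂ν - 4 * ∑ l ∈ Finset.range k,
          ∫ x, partialSups (fun l => prefixNorm v ρ l x) l *
            (prefixNorm v ρ (l + 1) x - prefixNorm v ρ l x) ∂ν := by
        rw [integral_sub (hN.const_mul 4)
          ((integrable_finsetSum _ fun l _ => hI l).const_mul 4),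
          integral_const_mul, integral_const_mul, integral_finsetSum _ fun l _ => hI l]
    _ ≤ 4 * ∫ x, prefixNorm v ρ k x ^ 2 ∂ν := by
        have := Finset.sum_nonneg fun l (_ : l ∈ Finset.range k) =>
          integral_increment_nonneg v ρ hν hL2 hv hρ l
        linarith

end prefixNorm

/-! ### The multiparameter maximal inequality -/

/-- The indicators, over all threshold vectors `k`, that all ranks of `t` are below `k`. -/
noncomputable def orthantCoeff {ι : Type*} {d : ℕ} (N : ℕ) (ρ : Fin d → ι → ℕ) (t : ι)
    (k : Fin d → Fin (N + 1)) : ℝ :=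
  if ∀ i, ρ i t < k i then 1 else 0

theorem norm_orthantCoeff_le {ι : Type*} {d : ℕ} (N : ℕ) (ρ : Fin d → ι → ℕ) (t : ι) :
    ‖orthantCoeff N ρ t‖ ≤ 1 :=
  (pi_norm_le_iff_of_nonneg zero_le_one).2 fun k => by
    unfold orthantCoeff; split_ifs <;> simp

/-- Wichura's multiparameter maximal inequality. -/
theorem integral_sq_norm_orthant_le [DecidableEq ι] {ν : Measure (ι → ℝ)} (hν : IsCentered ν)
    (hL2 : ∀ t, Integrable (fun x => x t ^ 2) ν) (N : ℕ) {d : ℕ} (ρ : Fin d → ι → ℕ)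
    (hρ : ∀ i, Function.Injective (ρ i)) (hN : ∀ i t, ρ i t < N) :
    ∫ x, ‖∑ t, x t • orthantCoeff N ρ t‖ ^ 2 ∂ν ≤ 4 ^ d * ∑ t, ∫ x, x t ^ 2 ∂ν := by
  induction d with
  -- There is only the empty threshold vector, so the norm is `|∑ x t|`, and centering removes the
  -- cross terms.
  | zero =>
    have hint : ∀ s t, Integrable (fun x : ι → ℝ => x s * x t) ν := fun s t => by
      refine integrable_of_le_sq_sum hL2 (by fun_prop) fun x => ?_
      rw [abs_mul, sq]
      have h : ∀ r, |x r| ≤ ∑ t, |x t| := fun r =>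
        Finset.single_le_sum (f := fun t => |x t|) (fun s _ => abs_nonneg _) (Finset.mem_univ r)
      exact mul_le_mul (h s) (h t) (abs_nonneg _) ((abs_nonneg _).trans (h s))
    have h1 : ∀ x : ι → ℝ, ‖∑ t, x t • orthantCoeff N ρ t‖ ^ 2 = ∑ s, ∑ t, x s * x t := by
      intro x
      have h2 : ∑ t, x t • orthantCoeff N ρ t = fun _ => ∑ t, x t := by
        ext k; simp [orthantCoeff]
      rw [h2, pi_norm_const, Real.norm_eq_abs, sq_abs, sq, Finset.sum_mul_sum]
    simp only [h1, pow_zero, one_mul]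
    rw [integral_finsetSum _ fun s _ => integrable_finsetSum _ fun t _ => hint s t]
    refine Finset.sum_le_sum fun s _ => ?_
    rw [integral_finsetSum _ fun t _ => hint s t, Finset.sum_eq_single s]
    · simp [sq]
    · intro t _ hts
      refine hν s (fun x => x t) (measurable_pi_apply t) (fun x r => ?_) (hint s t)
      rw [Function.update_of_ne hts]
    · simp
  | succ d ih =>
    -- Rank `0` serves as time; the other thresholds are the coordinates of a vector whose sup norm
    -- takes the maximum over them. Doob then costs a factor `4` per dimension.
    set v : ι → (Fin d → Fin (N + 1)) → ℝ := orthantCoeff N (fun i => ρ i.succ) with hv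
    have hv1 : ∀ t, ‖v t‖ ≤ 1 := norm_orthantCoeff_le N _
    have hfull : ∀ x, prefixNorm v (ρ 0) N x = ‖∑ t, x t • v t‖ := fun x => by
      unfold prefixNorm
      rw [Finset.filter_true_of_mem fun t _ => hN 0 t]
    have hsq : ∀ {g : (ι → ℝ) → ℝ}, Measurable g → (∀ x, 0 ≤ g x) → (∀ x, g x ≤ ∑ t, |x t|) →
        Integrable (fun x => g x ^ 2) ν := fun hg h0 hle =>
      integrable_of_le_sq_sum hL2 (hg.pow_const 2) fun x => by
        rw [abs_of_nonneg (sq_nonneg _)]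
        exact pow_le_pow_left₀ (h0 x) (hle x) 2
    have hle : ∀ x : ι → ℝ, ‖∑ t, x t • orthantCoeff N ρ t‖ ≤
        partialSups (fun l => prefixNorm v (ρ 0) l x) N := by
      intro x
      refine (pi_norm_le_iff_of_nonneg (partialSups_prefixNorm_nonneg v (ρ 0) N x)).2 fun k => ?_
      refine le_trans ?_ (le_partialSups_of_le (fun l => prefixNorm v (ρ 0) l x)
        (Nat.lt_succ_iff.1 (k 0).isLt))
      refine le_trans (le_of_eq ?_) (norm_le_pi_norm _ (fun i => k i.succ))
      congr 1
      rw [Finset.sum_apply, Finset.sum_apply, Finset.sum_filter]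
      refine Finset.sum_congr rfl fun t _ => ?_
      simp only [hv, Pi.smul_apply, smul_eq_mul, orthantCoeff, Fin.forall_fin_succ]
      by_cases h0 : ρ 0 t < (k 0 : ℕ) <;> simp [h0]
    have hcont : Continuous fun x : ι → ℝ => ‖∑ t, x t • orthantCoeff N ρ t‖ := by fun_prop
    calc ∫ x, ‖∑ t, x t • orthantCoeff N ρ t‖ ^ 2 ∂ν
        ≤ ∫ x, (partialSups (fun l => prefixNorm v (ρ 0) l x) N) ^ 2 ∂ν := by
          have hp := partialSups_prefixNorm_le v (ρ 0) hv1 N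
          refine integral_mono (hsq hcont.measurable (fun x => norm_nonneg _)
            fun x => (hle x).trans (hp x)) (hsq (measurable_partialSups_prefixNorm v (ρ 0) N)
            (partialSups_prefixNorm_nonneg v (ρ 0) N) hp) fun x => ?_
          exact pow_le_pow_left₀ (norm_nonneg _) (hle x) 2
      _ ≤ 4 * ∫ x, prefixNorm v (ρ 0) N x ^ 2 ∂ν :=
          integral_sq_partialSups_le v (ρ 0) hν hL2 hv1 (hρ 0) N
      _ ≤ 4 * (4 ^ d * ∑ t, ∫ x, x t ^ 2 ∂ν) := by
          simp only [hfull]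
          exact mul_le_mul_of_nonneg_left (ih (fun i => ρ i.succ) (fun i => hρ _)
            fun i => hN _) (by norm_num)
      _ = 4 ^ (d + 1) * ∑ t, ∫ x, x t ^ 2 ∂ν := by ring

/-! ### Random designs: partition by rank orders -/

variable {Ω : Type*} [MeasurableSpace Ω]

/-- Restricting to an event determined by the covariates `X`, and localizing the errors
through the covariates, keeps conditionally centered independent errors centered. -/
theorem isCentered_map_restrict {P : Measure Ω} [IsProbabilityMeasure P] {ι D : Type*}
    [Fintype ι] [DecidableEq ι] [MeasurableSpace D] {X : ι → Ω → D} {e : ι → Ω → ℝ}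
    (hX : ∀ t, Measurable (X t)) (he : ∀ t, Measurable (e t))
    (hindep : iIndepFun (fun t ω => (X t ω, e t ω)) P)
    (hmean : ∀ t, ∀ B : Set D, MeasurableSet B → ∫ ω in X t ⁻¹' B, e t ω ∂P = 0)
    {A : Set (ι → D)} (hA : MeasurableSet A) {B : Set D} (hB : MeasurableSet B) :
    IsCentered ((P.restrict {ω | (fun t => X t ω) ∈ A}).map
      fun ω t => (X t ⁻¹' B).indicator (e t) ω) := by
  classical
  intro t φ hφ hφt hint
  have hEm : Measurable fun (ω : Ω) (t : ι) => (X t ⁻¹' B).indicator (e t) ω :=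
    measurable_pi_iff.2 fun t => (he t).indicator (hX t hB)
  have hAm : MeasurableSet {ω | (fun t => X t ω) ∈ A} := (measurable_pi_iff.2 hX) hA
  have hgm : Measurable fun x : ι → ℝ => x t * φ x := (measurable_pi_apply t).mul hφ
  rw [integral_map hEm.aemeasurable hgm.aestronglyMeasurable]
  rw [integrable_map_measure hgm.aestronglyMeasurable hEm.aemeasurable] at hint
  rw [← integral_indicator hAm]
  have hint' := (integrable_indicator_iff hAm).2 hint
  set T : Finset ι := {t}ᶜ with hT
  have hnt : ∀ {s}, s ∉ T → s = t := fun {s} hs => by simpa [hT] using hs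
  have htT : t ∉ T := by simp [hT]
  -- `cfg` and `ψ` rebuild the design and the localized errors from the pairs other than `t`. Slot
  -- `t` of the design is the free variable `z`; slot `t` of the errors is `0`, harmless because `φ`
  -- ignores it.
  set cfg : D → (T → D × ℝ) → ι → D := fun z y s =>
    if h : s ∈ T then (y ⟨s, h⟩).1 else z with hcfg
  set ψ : (T → D × ℝ) → ι → ℝ := fun y s =>
    if h : s ∈ T then (Prod.fst ⁻¹' B).indicator Prod.snd (y ⟨s, h⟩) else 0 with hψ
  have hcfgm : Measurable fun q : D × (T → D × ℝ) => cfg q.1 q.2 := by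
    refine measurable_pi_iff.2 fun s => ?_
    by_cases h : s ∈ T
    · simp only [hcfg, h, dif_pos]; fun_prop
    · simp only [hcfg, h, dif_neg, not_false_eq_true]; fun_prop
  have hψm : Measurable ψ := by
    refine measurable_pi_iff.2 fun s => ?_
    by_cases h : s ∈ T
    · simp only [hψ, h, dif_pos]
      exact (measurable_snd.indicator (measurable_fst hB)).comp (measurable_pi_apply _)
    · simp only [hψ, h, dif_neg, not_false_eq_true]; fun_prop
  set G : Set (D × (T → D × ℝ)) := {q | q.1 ∈ B ∧ cfg q.1 q.2 ∈ A} with hG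
  have hGm : MeasurableSet G := (measurable_fst hB).inter (hcfgm hA)
  set F : (D × ℝ) × (T → D × ℝ) → ℝ := fun q =>
    q.1.2 * G.indicator 1 (q.1.1, q.2) * φ (ψ q.2) with hF
  have hFm : Measurable F := by
    refine Measurable.mul (Measurable.mul (by fun_prop) ?_) (by fun_prop)
    exact (measurable_one.indicator hGm).comp (by fun_prop)
  set Z : Ω → D × ℝ := fun ω => (X t ω, e t ω) with hZ
  set Y : Ω → T → D × ℝ := fun ω s => (X s ω, e s ω) with hY
  have hZm : Measurable Z := (hX t).prodMk (he t)
  have hYm : Measurable Y := measurable_pi_iff.2 fun s => (hX s).prodMk (he s)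
  have hind : IndepFun Z Y P := by
    have := hindep.indepFun_finset {t} T (by simp [hT]) (fun s => (hX s).prodMk (he s))
    exact this.comp (φ := fun z : (({t} : Finset ι) → D × ℝ) => z ⟨t, by simp⟩) (ψ := id)
      (measurable_pi_apply (X := fun _ => D × ℝ) _) measurable_id
  have heq : ({ω | (fun t => X t ω) ∈ A}.indicator fun ω =>
      (X t ⁻¹' B).indicator (e t) ω * φ fun s => (X s ⁻¹' B).indicator (e s) ω) =
      fun ω => F (Z ω, Y ω) := by
    ext ω
    have h1 : cfg (X t ω) (Y ω) = fun s => X s ω := by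
      ext s
      simp only [hcfg, hY]
      split_ifs with h
      · rfl
      · rw [hnt h]
    have h2 : φ (ψ (Y ω)) = φ fun s => (X s ⁻¹' B).indicator (e s) ω := by
      rw [← hφt (fun s => (X s ⁻¹' B).indicator (e s) ω) 0]
      congr 1
      ext s
      by_cases h : s ∈ T
      · have hst : s ≠ t := fun h' => htT (h' ▸ h)
        simp only [hψ, h, dif_pos, Function.update_of_ne hst, hY]
        rfl
      · rw [hnt h]
        simp [hψ, htT]
    simp only [hF, hZ, h2, hG, Set.indicator_apply, Set.mem_ofPred_eq, h1, Set.mem_preimage]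
    by_cases hb : X t ω ∈ B <;> by_cases ha : (fun s => X s ω) ∈ A <;> simp [hb, ha]
  have hmap : P.map (fun ω => (Z ω, Y ω)) = (P.map Z).prod (P.map Y) :=
    hind.map_prod_eq_prod_map_map hZm.aemeasurable hYm.aemeasurable
  have : IsProbabilityMeasure (P.map Z) := Measure.isProbabilityMeasure_map hZm.aemeasurable
  have : IsProbabilityMeasure (P.map Y) := Measure.isProbabilityMeasure_map hYm.aemeasurable
  have hFint : Integrable F ((P.map Z).prod (P.map Y)) := by
    rw [← hmap, integrable_map_measure hFm.aestronglyMeasurable (hZm.prodMk hYm).aemeasurable]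
    have h3 := hint'
    simp only [Function.comp_def] at h3
    rw [heq] at h3
    exact h3
  rw [heq, ← integral_map (φ := fun ω => (Z ω, Y ω)) (f := F) (hZm.prodMk hYm).aemeasurable
    hFm.aestronglyMeasurable, hmap, integral_prod_symm F hFint]
  -- With the other pairs frozen at `y`, the remaining constraint is that `X t` lies in a measurable
  -- section of `G`, so `hmean` applies to that section.
  refine integral_eq_zero_of_ae (.of_forall fun y => ?_)
  simp only [hF, Pi.zero_apply]
  rw [integral_mul_const]
  refine mul_eq_zero_of_left ?_ _
  have hGy : MeasurableSet {z | (z, y) ∈ G} := measurable_prodMk_right hGm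
  rw [integral_map hZm.aemeasurable]
  · rw [← hmean t _ hGy, ← integral_indicator (hX t hGy)]
    congr 1
    ext ω
    by_cases h : (X t ω, y) ∈ G <;> simp [hZ, h]
  · refine (measurable_snd.mul ?_).aestronglyMeasurable
    exact (measurable_one.indicator hGm).comp (by fun_prop)

/-- A monotone real sequence on `Fin n` lies below any level exactly on an initial segment. -/
theorem exists_forall_le_iff_lt {n : ℕ} {g : Fin n → ℝ} (hg : Monotone g) (q : ℝ) :
    ∃ k : Fin (n + 1), ∀ j : Fin n, g j ≤ q ↔ (j : ℕ) < k := by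
  refine ⟨⟨(Finset.univ.filter fun j => g j ≤ q).card, ?_⟩, fun j => ?_⟩
  · exact Nat.lt_succ_of_le ((Finset.card_le_univ _).trans (by simp))
  · constructor
    · intro hj
      have : Finset.Iic j ⊆ Finset.univ.filter fun j => g j ≤ q := fun i hi => by
        simpa using (hg (Finset.mem_Iic.1 hi)).trans hj
      have := Finset.card_le_card this
      rw [Fin.card_Iic] at this
      simpa using this
    · intro hj
      by_contra h
      have : (Finset.univ.filter fun j => g j ≤ q) ⊆ Finset.Iio j := fun i hi => by
        rw [Finset.mem_Iio]
        by_contra hij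
        exact h ((hg (not_lt.1 hij)).trans (Finset.mem_filter.1 hi).2)
      have := Finset.card_le_card this
      rw [Fin.card_Iio] at this
      simp only at hj
      omega

/-- `Tuple.sort` is characterized by order relations between entries, with ties broken by index, so
finitely many comparisons decide the event. -/
theorem measurableSet_sort_eq {n : ℕ} (σ : Equiv.Perm (Fin n)) :
    MeasurableSet {g : Fin n → ℝ | Tuple.sort g = σ} := by
  have : {g : Fin n → ℝ | Tuple.sort g = σ} = {g | (∀ i j, i ≤ j → g (σ i) ≤ g (σ j)) ∧
      ∀ i j, i < j → g (σ i) = g (σ j) → σ i < σ j} := by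
    ext g
    simp only [Set.mem_ofPred_eq]
    rw [eq_comm, Tuple.eq_sort_iff]
    rfl
  simp only [this, Set.ofPred_and, Set.ofPred_forall]
  refine MeasurableSet.inter ?_ ?_ <;>
    refine MeasurableSet.iInter fun i => MeasurableSet.iInter fun j =>
      MeasurableSet.iInter fun h => ?_
  · exact measurableSet_le (measurable_pi_apply _) (measurable_pi_apply _)
  · by_cases h' : σ i < σ j
    · simp [h']
    · simp only [h', imp_false]
      have : MeasurableSet {g : Fin n → ℝ | g (σ i) = g (σ j)} :=
        measurableSet_eq_fun (measurable_pi_apply _) (measurable_pi_apply _)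
      exact this.compl

/-- An integrable majorant of the squared error sums over all orthants inside a fixed set. -/
theorem exists_orthant_majorant {P : Measure Ω} [IsProbabilityMeasure P] {n d : ℕ}
    {X : Fin n → Ω → Fin d → ℝ} {e : Fin n → Ω → ℝ}
    (hX : ∀ t, Measurable (X t)) (he : ∀ t, Measurable (e t))
    (hindep : iIndepFun (fun t ω => (X t ω, e t ω)) P)
    (hmean : ∀ t, ∀ B : Set (Fin d → ℝ), MeasurableSet B → ∫ ω in X t ⁻¹' B, e t ω ∂P = 0)
    (hL2 : ∀ t, MemLp (e t) 2 P) {B : Set (Fin d → ℝ)} (hB : MeasurableSet B) (s : ℝ) :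
    ∃ W : Ω → ℝ, Integrable W P ∧ (∀ ω, 0 ≤ W ω) ∧
      (∀ ω (q : Fin d → ℝ),
        (∑ t, {t | ∀ i, s * X t ω i ≤ q i}.indicator
          (fun t => (X t ⁻¹' B).indicator (e t) ω) t) ^ 2 ≤ W ω) ∧
      ∫ ω, W ω ∂P ≤ 4 ^ d * ∑ t, ∫ ω in X t ⁻¹' B, e t ω ^ 2 ∂P := by
  classical
  set E : Ω → Fin n → ℝ := fun ω t => (X t ⁻¹' B).indicator (e t) ω with hE
  have hEm : Measurable E := measurable_pi_iff.2 fun t => (he t).indicator (hX t hB)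
  set key : (Fin n → Fin d → ℝ) → Fin d → Fin n → ℝ := fun x i t => s * x t i with hkey
  set rank : (Fin d → Equiv.Perm (Fin n)) → Fin d → Fin n → ℕ :=
    fun σ i t => ((σ i).symm t : ℕ) with hrank
  set A : (Fin d → Equiv.Perm (Fin n)) → Set (Fin n → Fin d → ℝ) :=
    fun σ => {x | (fun i => Tuple.sort (key x i)) = σ} with hA
  have hAm : ∀ σ, MeasurableSet (A σ) := by
    intro σ
    have : A σ = ⋂ i, (fun x => key x i) ⁻¹' {g | Tuple.sort g = σ i} := by
      ext x; simp [hA, funext_iff]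
    rw [this]
    refine MeasurableSet.iInter fun i => ?_
    refine measurableSet_preimage ?_ (measurableSet_sort_eq _)
    simp only [hkey]; fun_prop
  have hAm' : ∀ σ, MeasurableSet {ω | (fun t => X t ω) ∈ A σ} :=
    fun σ => (measurable_pi_iff.2 hX) (hAm σ)
  have hEsq : ∀ t, Integrable (fun ω => E ω t ^ 2) P := fun t =>
    ((hL2 t).indicator (hX t hB)).integrable_sq
  have hsqm : ∀ (t : Fin n) {ν : Measure (Fin n → ℝ)},
      AEStronglyMeasurable (fun x : Fin n → ℝ => x t ^ 2) ν := fun t _ =>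
    ((measurable_pi_apply t).pow_const 2).aestronglyMeasurable
  set w : (Fin d → Equiv.Perm (Fin n)) → (Fin n → ℝ) → ℝ :=
    fun σ x => ‖∑ t, x t • orthantCoeff n (rank σ) t‖ ^ 2 with hw
  have hwc : ∀ σ, Continuous (w σ) := fun σ => by simp only [hw]; fun_prop
  have hint : ∀ σ, Integrable (fun ω => w σ (E ω)) P := by
    intro σ
    have hL2' : ∀ t, Integrable (fun x : Fin n → ℝ => x t ^ 2) (P.map E) := fun t => by
      rw [integrable_map_measure (hsqm t) hEm.aemeasurable]
      exact hEsq t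
    have := integrable_of_le_sq_sum hL2' (hwc σ).measurable fun x => by
      rw [abs_of_nonneg (sq_nonneg _)]
      refine pow_le_pow_left₀ (norm_nonneg _) ((norm_sum_le _ _).trans ?_) 2
      refine Finset.sum_le_sum fun t _ => ?_
      rw [norm_smul, Real.norm_eq_abs]
      exact mul_le_of_le_one_right (abs_nonneg _) (norm_orthantCoeff_le n _ t)
    exact this.comp_measurable hEm
  -- On the piece `A σ` the coordinate orders are fixed, so every orthant sum is one of the
  -- threshold sums with the deterministic ranks of `σ`.
  refine ⟨fun ω => ∑ σ, {ω | (fun t => X t ω) ∈ A σ}.indicator (fun ω => w σ (E ω)) ω,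
    integrable_finsetSum _ fun σ _ => (hint σ).indicator (hAm' σ), fun ω =>
      Finset.sum_nonneg fun σ _ => Set.indicator_nonneg (fun _ _ => sq_nonneg _) _,
      fun ω q => ?_, ?_⟩
  · set σ : Fin d → Equiv.Perm (Fin n) := fun i => Tuple.sort (key (fun t => X t ω) i) with hσ
    have hmem : ω ∈ {ω | (fun t => X t ω) ∈ A σ} := rfl
    refine le_trans ?_ (Finset.single_le_sum (f := fun σ =>
      {ω | (fun t => X t ω) ∈ A σ}.indicator (fun ω => w σ (E ω)) ω)
      (fun σ _ => Set.indicator_nonneg (fun _ _ => sq_nonneg _) _) (Finset.mem_univ σ))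
    simp only [Set.indicator_of_mem hmem]
    have hk : ∀ i, ∃ k : Fin (n + 1), ∀ j : Fin n,
        (key (fun t => X t ω) i ∘ σ i) j ≤ q i ↔ (j : ℕ) < k := fun i =>
      exists_forall_le_iff_lt (Tuple.monotone_sort _) (q i)
    choose k hk using hk
    rw [← sq_abs]
    refine pow_le_pow_left₀ (abs_nonneg _) (le_trans (le_of_eq ?_) (norm_le_pi_norm _ k)) 2
    rw [Real.norm_eq_abs, Finset.sum_apply]
    congr 1
    refine Finset.sum_congr rfl fun t _ => ?_
    have : (∀ i, s * X t ω i ≤ q i) ↔ ∀ i, rank σ i t < k i := by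
      refine forall_congr' fun i => ?_
      rw [hrank, ← hk i ((σ i).symm t)]
      simp [hkey]
    simp only [Set.indicator_apply (s := {t | ∀ i, s * X t ω i ≤ q i}), Set.mem_ofPred_eq, this,
      Pi.smul_apply, smul_eq_mul, orthantCoeff]
    split_ifs <;> simp [hE]
  · rw [integral_finsetSum _ fun σ _ => (hint σ).indicator (hAm' σ)]
    have hσ : ∀ σ, ∫ ω, {ω | (fun t => X t ω) ∈ A σ}.indicator (fun ω => w σ (E ω)) ω ∂P ≤
        4 ^ d * ∑ t, ∫ ω, {ω | (fun t => X t ω) ∈ A σ}.indicator (fun ω => E ω t ^ 2) ω ∂P := by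
      intro σ
      have hν := isCentered_map_restrict hX he hindep hmean (hAm σ) hB
      have := integral_sq_norm_orthant_le hν (fun t => by
        rw [integrable_map_measure (hsqm t) hEm.aemeasurable]
        exact (hEsq t).restrict) n (rank σ)
        (fun i => Fin.val_injective.comp (σ i).symm.injective) (fun i t => Fin.isLt _)
      rw [integral_map hEm.aemeasurable (hwc σ).aestronglyMeasurable] at this
      simp only [integral_indicator (hAm' σ)]
      refine this.trans_eq ?_
      congr 1
      refine Finset.sum_congr rfl fun t _ => ?_
      rw [integral_map hEm.aemeasurable (hsqm t)]
    -- The pieces partition `Ω`, so the restricted second moments add up exactly; no factor counting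
    -- permutations appears.
    refine (Finset.sum_le_sum fun σ _ => hσ σ).trans_eq ?_
    rw [← Finset.mul_sum, Finset.sum_comm]
    congr 1
    refine Finset.sum_congr rfl fun t _ => ?_
    rw [← integral_finsetSum _ fun σ _ => (hEsq t).indicator (hAm' σ),
      ← integral_indicator (hX t hB)]
    congr 1
    ext ω
    have : ∀ σ, {ω | (fun t => X t ω) ∈ A σ}.indicator (fun ω => E ω t ^ 2) ω =
        if (fun i => Tuple.sort (key (fun t => X t ω) i)) = σ then E ω t ^ 2 else 0 := by
      intro σ
      simp only [Set.indicator_apply, hA, Set.mem_ofPred_eq]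
    simp only [this, Finset.sum_ite_eq, Finset.mem_univ, if_true]
    simp only [hE, Set.indicator_apply]
    split_ifs <;> simp

/-! ### Boxes with a fixed corner and dyadic scales -/

/-- The points reached from `q` by a step of size at most `r` in the coordinatewise direction
given by the sign `s`. -/
def signedBox {d : ℕ} (s : ℝ) (q r : Fin d → ℝ) : Set (Fin d → ℝ) :=
  {x | ∀ i, 0 ≤ s * (x i - q i) ∧ s * (x i - q i) ≤ r i}

theorem measurableSet_signedBox {d : ℕ} (s : ℝ) (q r : Fin d → ℝ) :
    MeasurableSet (signedBox s q r) := by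
  simp only [signedBox, Set.ofPred_forall, Set.ofPred_and]
  refine MeasurableSet.iInter fun i => MeasurableSet.inter ?_ ?_
  · exact measurableSet_le (by fun_prop) (by fun_prop)
  · exact measurableSet_le (by fun_prop) (by fun_prop)

/-- The two signs let one majorant construction serve boxes anchored at their lower corner and boxes
anchored at their upper corner. -/
theorem signedBox_one {d : ℕ} (a b : Fin d → ℝ) : signedBox 1 a (b - a) = Set.Icc a b := by
  ext x
  simp only [signedBox, Set.mem_ofPred_eq, Set.mem_Icc, Pi.le_def, ← forall_and, Pi.sub_apply]
  exact forall_congr' fun i => ⟨fun h => ⟨by linarith [h.1], by linarith [h.2]⟩,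
    fun h => ⟨by linarith [h.1], by linarith [h.2]⟩⟩

theorem signedBox_neg_one {d : ℕ} (a b : Fin d → ℝ) :
    signedBox (-1) b (b - a) = Set.Icc a b := by
  ext x
  simp only [signedBox, Set.mem_ofPred_eq, Set.mem_Icc, Pi.le_def, ← forall_and, Pi.sub_apply]
  exact forall_congr' fun i => ⟨fun h => ⟨by linarith [h.2], by linarith [h.1]⟩,
    fun h => ⟨by linarith [h.2], by linarith [h.1]⟩⟩

/-- The sum factors over coordinates into geometric series with terms `2h · 2^(-j)`, each at most
`4h` uniformly in `N`. -/
theorem sum_dyadic_le (d N : ℕ) {h : ℝ} (hh : 0 ≤ h) :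
    ∑ J : Fin d → Fin N, (∏ i, 2 ^ ((J i : ℕ) + 1) * h) / ∏ i, (4 : ℝ) ^ (J i : ℕ) ≤
      (4 * h) ^ d := by
  have h1 : ∀ J : Fin d → Fin N, (∏ i, 2 ^ ((J i : ℕ) + 1) * h) / ∏ i, (4 : ℝ) ^ (J i : ℕ) =
      ∏ i, 2 * h * (1 / 2) ^ (J i : ℕ) := fun J => by
    rw [← Finset.prod_div_distrib]
    refine Finset.prod_congr rfl fun i _ => ?_
    rw [div_eq_iff (by positivity), pow_succ, mul_assoc (2 * h), ← mul_pow]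
    norm_num
    ring
  simp only [h1]
  rw [← Fintype.sum_pow (fun j : Fin N => 2 * h * (1 / 2 : ℝ) ^ (j : ℕ)) d]
  refine pow_le_pow_left₀ (Finset.sum_nonneg fun j _ => by positivity) ?_ d
  rw [← Finset.mul_sum, Fin.sum_univ_eq_sum_range (fun j => (1 / 2 : ℝ) ^ j)]
  have := sum_geometric_two_le N
  nlinarith

/-- An integrable majorant of the squared error sums over all signed boxes at `q`,
normalized by the square of the dyadic volume. -/
theorem exists_signedBox_majorant {Ω : Type*} [MeasurableSpace Ω] {P : Measure Ω}
    [IsProbabilityMeasure P] {n d : ℕ} {X : Fin n → Ω → Fin d → ℝ} {e : Fin n → Ω → ℝ}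
    (hX : ∀ t, Measurable (X t)) (he : ∀ t, Measurable (e t))
    (hindep : iIndepFun (fun t ω => (X t ω, e t ω)) P)
    (hmean : ∀ t, ∀ B : Set (Fin d → ℝ), MeasurableSet B → ∫ ω in X t ⁻¹' B, e t ω ∂P = 0)
    (hL2 : ∀ t, MemLp (e t) 2 P) (s : ℝ) (q : Fin d → ℝ) {K h : ℝ} (hh : 0 ≤ h)
    (hvar : ∀ t r, (∀ i, 0 ≤ r i) →
      ∫ ω in X t ⁻¹' signedBox s q r, e t ω ^ 2 ∂P ≤ K * ∏ i, r i) (hK : 0 ≤ K) (N : ℕ) :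
    ∃ V : Ω → ℝ, Integrable V P ∧ (∀ ω, 0 ≤ V ω) ∧
      (∀ ω (r : Fin d → ℝ) (J : Fin d → ℕ), (∀ i, J i < N) → (∀ i, r i ≤ 2 ^ (J i + 1) * h) →
        (∑ t, (X t ⁻¹' signedBox s q r).indicator (e t) ω) ^ 2 ≤ V ω * ∏ i, (4 : ℝ) ^ J i) ∧
      ∫ ω, V ω ∂P ≤ 16 ^ d * (n * K) * h ^ d := by
  have hW := fun J : Fin d → Fin N => exists_orthant_majorant hX he hindep hmean hL2
    (measurableSet_signedBox s q fun i => 2 ^ ((J i : ℕ) + 1) * h) s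
  choose W hWint hW0 hWle hWE using hW
  have hWdiv : ∀ J, Integrable (fun ω => W J ω / ∏ i, (4 : ℝ) ^ (J i : ℕ)) P :=
    fun J => (hWint J).div_const _
  have hWdiv0 : ∀ J ω, 0 ≤ W J ω / ∏ i, (4 : ℝ) ^ (J i : ℕ) :=
    fun J ω => div_nonneg (hW0 J ω) (by positivity)
  -- A sum over scales replaces the maximum: it dominates each scale, and its mean is controlled by
  -- the geometric series.
  refine ⟨fun ω => ∑ J, W J ω / ∏ i, (4 : ℝ) ^ (J i : ℕ), integrable_finsetSum _ fun J _ => hWdiv J,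
    fun ω => Finset.sum_nonneg fun J _ => hWdiv0 J ω, fun ω r J hJ hr => ?_, ?_⟩
  · set J' : Fin d → Fin N := fun i => ⟨J i, hJ i⟩ with hJ'
    rw [← div_le_iff₀ (by positivity)]
    refine le_trans ?_ (Finset.single_le_sum (f := fun J => W J ω / ∏ i, (4 : ℝ) ^ (J i : ℕ))
      (fun J _ => hWdiv0 J ω) (Finset.mem_univ J'))
    refine div_le_div_of_nonneg_right ?_ (by positivity)
    refine le_trans (le_of_eq ?_) (hWle J' ω fun i => s * q i + r i)
    congr 1
    refine Finset.sum_congr rfl fun t _ => ?_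
    -- Inside the dyadic box the constraints at `q` hold already, so the smaller box is cut out by
    -- an orthant.
    have hiff : X t ω ∈ signedBox s q r ↔ (∀ i, s * X t ω i ≤ s * q i + r i) ∧
        X t ω ∈ signedBox s q fun i => 2 ^ ((J' i : ℕ) + 1) * h := by
      simp only [signedBox, Set.mem_ofPred_eq, ← forall_and]
      refine forall_congr' fun i => ?_
      have := hr i
      simp only [mul_sub, hJ']
      constructor
      · rintro ⟨h1, h2⟩; refine ⟨?_, ?_, ?_⟩ <;> linarith
      · rintro ⟨h1, h2, h3⟩; refine ⟨?_, ?_⟩ <;> linarith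
    by_cases hm : X t ω ∈ signedBox s q r
    · have hm' := hiff.1 hm
      rw [Set.indicator_of_mem (show ω ∈ X t ⁻¹' signedBox s q r from hm),
        Set.indicator_of_mem (show t ∈ {t | ∀ i, s * X t ω i ≤ s * q i + r i} from hm'.1),
        Set.indicator_of_mem (Set.mem_preimage.2 hm'.2)]
    · rw [Set.indicator_of_notMem (show ω ∉ X t ⁻¹' signedBox s q r from hm)]
      by_cases h1 : ∀ i, s * X t ω i ≤ s * q i + r i
      · rw [Set.indicator_of_mem (show t ∈ {t | ∀ i, s * X t ω i ≤ s * q i + r i} from h1),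
          Set.indicator_of_notMem fun h2 => hm (hiff.2 ⟨h1, Set.mem_preimage.1 h2⟩)]
      · rw [Set.indicator_of_notMem
          (show t ∉ {t | ∀ i, s * X t ω i ≤ s * q i + r i} from h1)]
  · rw [integral_finsetSum _ fun J _ => hWdiv J]
    calc ∑ J, ∫ ω, W J ω / ∏ i, (4 : ℝ) ^ (J i : ℕ) ∂P
        ≤ ∑ J : Fin d → Fin N, 4 ^ d * (n * K) *
            ((∏ i, 2 ^ ((J i : ℕ) + 1) * h) / ∏ i, (4 : ℝ) ^ (J i : ℕ)) := by
          refine Finset.sum_le_sum fun J _ => ?_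
          rw [integral_div, ← mul_div_assoc]
          refine div_le_div_of_nonneg_right ((hWE J).trans ?_) (by positivity)
          rw [mul_assoc]
          refine mul_le_mul_of_nonneg_left ?_ (by positivity)
          refine (Finset.sum_le_sum fun t _ => hvar t _ fun i => by positivity).trans_eq ?_
          simp [mul_assoc]
      _ ≤ 4 ^ d * (n * K) * (4 * h) ^ d := by
          rw [← Finset.mul_sum]
          exact mul_le_mul_of_nonneg_left (sum_dyadic_le d N hh) (by positivity)
      _ = 16 ^ d * (n * K) * h ^ d := by
          rw [mul_pow, show (16 : ℝ) = 4 * 4 by norm_num, mul_pow]; ring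

/-! ### Counts, averages and the two estimators -/

open Classical in
theorem count_eq_card {d : ℕ} (n : ℕ) (u : ℕ → Fin d → ℝ) (B : Set (Fin d → ℝ)) :
    count n u B = ((Finset.range n).filter fun t => u t ∈ B).card := by
  rw [count, ← Set.ncard_coe_finset]
  congr 1
  ext t
  simp

theorem disjoint_cell {d n : ℕ} (hM : 0 < gridSize d n) {k k' : Fin d → ℕ} (hk : k ≠ k') :
    Disjoint (cell d n k) (cell d n k') := by
  have hh : 0 < meshWidth d n := by unfold meshWidth; positivity
  rw [Set.disjoint_left]
  intro x hx hx'
  apply hk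
  ext i
  obtain ⟨h1, h2⟩ := hx i trivial
  obtain ⟨h3, h4⟩ := hx' i trivial
  have h5 : (k i : ℝ) - 1 < k' i := lt_of_mul_lt_mul_right (h1.trans_le h4) hh.le
  have h6 : (k' i : ℝ) - 1 < k i := lt_of_mul_lt_mul_right (h3.trans_le h2) hh.le
  have h7 : k i < k' i + 1 := by exact_mod_cast (by linarith : (k i : ℝ) < k' i + 1)
  have h8 : k' i < k i + 1 := by exact_mod_cast (by linarith : (k' i : ℝ) < k i + 1)
  omega

/-- A set containing a grid-aligned box contains many design points. -/
theorem mul_prod_le_count {d n : ℕ} (hM : 0 < gridSize d n) {u : ℕ → Fin d → ℝ} {L : ℝ}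
    (hL : ∀ k : Fin d → ℕ, (∀ i, 1 ≤ k i ∧ k i ≤ gridSize d n) → L ≤ count n u (cell d n k))
    {lo w : Fin d → ℕ} (hhi : ∀ i, lo i + w i ≤ gridSize d n) {R : Set (Fin d → ℝ)}
    (hR : Set.Icc (fun i => (lo i : ℝ) * meshWidth d n)
      (fun i => ((lo i : ℝ) + w i) * meshWidth d n) ⊆ R) :
    L * ∏ i, (w i : ℝ) ≤ count n u R := by
  classical
  have hh : 0 < meshWidth d n := by unfold meshWidth; positivity
  -- Cell indices start at `1`: cell `k` ends at `k h`, so the box starting at `lo h` begins with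
  -- cell `lo + 1`.
  set S : Finset (Fin d → ℕ) := Fintype.piFinset fun i => Finset.Ioc (lo i) (lo i + w i) with hS
  have hcard : (S.card : ℝ) = ∏ i, (w i : ℝ) := by
    simp [hS, Fintype.card_piFinset]
  have hmem : ∀ k ∈ S, ∀ i, lo i < k i ∧ k i ≤ lo i + w i := fun k hk i => by
    simpa using Fintype.mem_piFinset.1 hk i
  have hsub : ∀ k ∈ S, cell d n k ⊆ R := by
    intro k hk x hx
    refine hR ⟨fun i => ?_, fun i => ?_⟩
    · refine le_trans ?_ (hx i trivial).1.le
      refine mul_le_mul_of_nonneg_right ?_ hh.le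
      have : (lo i : ℝ) + 1 ≤ k i := by exact_mod_cast (hmem k hk i).1
      linarith
    · refine (hx i trivial).2.trans (mul_le_mul_of_nonneg_right ?_ hh.le)
      exact_mod_cast (hmem k hk i).2
  have hle : ∑ k ∈ S, count n u (cell d n k) ≤ count n u R := by
    simp only [count_eq_card]
    rw [← Finset.card_biUnion]
    · refine Finset.card_le_card fun t ht => ?_
      obtain ⟨k, hk, ht⟩ := Finset.mem_biUnion.1 ht
      rw [Finset.mem_filter] at ht ⊢
      exact ⟨ht.1, hsub k hk ht.2⟩
    · intro k _ k' _ hkk'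
      rw [Function.onFun, Finset.disjoint_left]
      intro t ht ht'
      exact Set.disjoint_left.1 (disjoint_cell hM hkk') (Finset.mem_filter.1 ht).2
        (Finset.mem_filter.1 ht').2
  calc L * ∏ i, (w i : ℝ) = ∑ _k ∈ S, L := by rw [Finset.sum_const, nsmul_eq_mul, hcard, mul_comm]
    _ ≤ ∑ k ∈ S, (count n u (cell d n k) : ℝ) := Finset.sum_le_sum fun k hk =>
        hL k fun i => by have := hmem k hk i; have := hhi i; omega
    _ ≤ count n u R := by exact_mod_cast hle

section avg

variable {d : ℕ} {n : ℕ} {u : ℕ → Fin d → ℝ} {c : ℝ}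

/-- Since `4^j = (2^j)^2`, the dyadic normalization of `V` cancels against the squared count, and
the bound no longer depends on the scale. -/
theorem sq_avg_le {e : ℕ → ℝ} {R : Set (Fin d → ℝ)} {V L : ℝ} {J : Fin d → ℕ} (hL : 0 < L)
    (hV : (∑ t : Fin n, {t : Fin n | u t ∈ R}.indicator (fun t : Fin n => e t) t) ^ 2 ≤
      V * ∏ i, (4 : ℝ) ^ J i)
    (hcount : L * ∏ i, ((2 ^ J i : ℕ) : ℝ) ≤ count n u R) :
    (avg n u e c R) ^ 2 ≤ V / L ^ 2 := by
  classical
  have hpos : 0 < L * ∏ i, ((2 ^ J i : ℕ) : ℝ) := by positivity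
  have hc : (0 : ℝ) < count n u R := hpos.trans_le hcount
  have hc0 : count n u R ≠ 0 := by
    have : 0 < count n u R := by exact_mod_cast hc
    omega
  have h4 : ∏ i, (4 : ℝ) ^ J i = (∏ i, ((2 ^ J i : ℕ) : ℝ)) ^ 2 := by
    rw [← Finset.prod_pow]
    refine Finset.prod_congr rfl fun i _ => ?_
    push_cast
    rw [← pow_mul, mul_comm, pow_mul]; norm_num
  have hsum : ∑ t : Fin n, {t : Fin n | u t ∈ R}.indicator (fun t : Fin n => e t) t =
      ∑ t ∈ Finset.range n, if u t ∈ R then e t else 0 := by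
    rw [← Fin.sum_univ_eq_sum_range fun t => if u t ∈ R then e t else 0]
    refine Finset.sum_congr rfl fun t _ => ?_
    simp [Set.indicator_apply]
  rw [hsum] at hV
  rw [avg, if_neg hc0, div_pow, div_le_div_iff₀ (by positivity) (by positivity)]
  have hV0 : 0 ≤ V := by
    by_contra h
    have : V * ∏ i, (4 : ℝ) ^ J i < 0 := mul_neg_of_neg_of_pos (not_le.1 h) (by positivity)
    linarith [sq_nonneg (∑ t ∈ Finset.range n, if u t ∈ R then e t else 0)]
  calc _ ≤ V * (∏ i, (4 : ℝ) ^ J i) * L ^ 2 := mul_le_mul_of_nonneg_right hV (sq_nonneg L)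
    _ = V * (L * ∏ i, ((2 ^ J i : ℕ) : ℝ)) ^ 2 := by rw [h4]; ring
    _ ≤ V * (count n u R : ℝ) ^ 2 :=
        mul_le_mul_of_nonneg_left (pow_le_pow_left₀ hpos.le hcount 2) hV0

/-- Empty sets must be excluded: both averages would equal `c`, and `c ≤ F + c` fails for negative
`F`. -/
theorem avg_le_add {y e : ℕ → ℝ} {R : Set (Fin d → ℝ)} {F : ℝ} (hc : count n u R ≠ 0)
    (h : ∀ t, u t ∈ R → y t ≤ F + e t) : avg n u y c R ≤ F + avg n u e c R := by
  classical
  have hc' : (0 : ℝ) < count n u R := by exact_mod_cast Nat.pos_of_ne_zero hc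
  rw [avg, avg, if_neg hc, if_neg hc, ← sub_le_iff_le_add, ← sub_div, div_le_iff₀ hc',
    ← Finset.sum_sub_distrib, count_eq_card, mul_comm, ← nsmul_eq_mul, ← Finset.sum_const,
    Finset.sum_filter]
  refine Finset.sum_le_sum fun t _ => ?_
  split_ifs with ht
  · linarith [h t ht]
  · simp

theorem add_le_avg {y e : ℕ → ℝ} {R : Set (Fin d → ℝ)} {F : ℝ} (hc : count n u R ≠ 0)
    (h : ∀ t, u t ∈ R → F + e t ≤ y t) : F + avg n u e c R ≤ avg n u y c R := by
  have := avg_le_add (c := c) (F := -F) (y := e) (e := y) hc fun t ht => by linarith [h t ht]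
  linarith

/-- A crude bound uniform in `R`, which supplies the boundedness needed for real suprema and infima
over corners. -/
theorem abs_avg_le (y : ℕ → ℝ) (R : Set (Fin d → ℝ)) :
    |avg n u y c R| ≤ |c| + ∑ t ∈ Finset.range n, |y t| := by
  classical
  have hs : 0 ≤ ∑ t ∈ Finset.range n, |y t| := Finset.sum_nonneg fun t _ => abs_nonneg _
  rw [avg]
  split_ifs with hc
  · linarith
  · have hc' : (1 : ℝ) ≤ count n u R := by exact_mod_cast Nat.one_le_iff_ne_zero.2 hc
    rw [abs_div, abs_of_nonneg (by linarith : (0 : ℝ) ≤ count n u R)]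
    refine (div_le_self (abs_nonneg _) hc').trans ?_
    refine (Finset.abs_sum_le_sum_abs _ _).trans ?_
    have : ∑ t ∈ Finset.range n, |if u t ∈ R then y t else 0| ≤ ∑ t ∈ Finset.range n, |y t| :=
      Finset.sum_le_sum fun t _ => by split_ifs <;> simp
    linarith [abs_nonneg c]

theorem upperEst_le {y : ℕ → ℝ} {x b : Fin d → ℝ} (hx : 0 ≤ x) (hb : b ∈ Set.Icc x 1) {K : ℝ}
    (h : ∀ a ∈ Set.Icc 0 x, avg n u y c (Set.Icc a b) ≤ K) : upperEst n u y c x ≤ K := by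
  have : Nonempty (Set.Icc (0 : Fin d → ℝ) x) := ⟨⟨0, le_rfl, hx⟩⟩
  refine (ciInf_le (f := fun b : Set.Icc x (1 : Fin d → ℝ) =>
    ⨆ a : Set.Icc (0 : Fin d → ℝ) x, avg n u y c (Set.Icc (a : Fin d → ℝ) (b : Fin d → ℝ)))
    ?_ ⟨b, hb⟩).trans (ciSup_le fun a => h a a.2)
  refine ⟨-(|c| + ∑ t ∈ Finset.range n, |y t|), ?_⟩
  rintro _ ⟨b', rfl⟩
  have hbd : ∀ a : Set.Icc (0 : Fin d → ℝ) x, avg n u y c (Set.Icc (a : Fin d → ℝ) b') ≤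
      |c| + ∑ t ∈ Finset.range n, |y t| := fun a => (le_abs_self _).trans (abs_avg_le _ _)
  refine le_trans ?_ (le_ciSup (f := fun a : Set.Icc (0 : Fin d → ℝ) x =>
    avg n u y c (Set.Icc (a : Fin d → ℝ) b')) ⟨_, by rintro _ ⟨a, rfl⟩; exact hbd a⟩
    ⟨0, le_rfl, hx⟩)
  exact neg_le_of_abs_le (abs_avg_le _ _)

theorem le_lowerEst {y : ℕ → ℝ} {x a : Fin d → ℝ} (hx : x ≤ 1) (ha : a ∈ Set.Icc 0 x) {K : ℝ}
    (h : ∀ b ∈ Set.Icc x 1, K ≤ avg n u y c (Set.Icc a b)) : K ≤ lowerEst n u y c x := by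
  have : Nonempty (Set.Icc x (1 : Fin d → ℝ)) := ⟨⟨1, hx, le_rfl⟩⟩
  refine le_trans (le_ciInf (ι := Set.Icc x (1 : Fin d → ℝ)) fun b => h b b.2)
    (le_ciSup (ι := Set.Icc (0 : Fin d → ℝ) x) (f := fun a => ⨅ b : Set.Icc x (1 : Fin d → ℝ),
      avg n u y c (Set.Icc (a : Fin d → ℝ) (b : Fin d → ℝ))) ?_ ⟨a, ha⟩)
  refine ⟨|c| + ∑ t ∈ Finset.range n, |y t|, ?_⟩
  rintro _ ⟨a', rfl⟩
  have hbd : ∀ b : Set.Icc x (1 : Fin d → ℝ), -(|c| + ∑ t ∈ Finset.range n, |y t|) ≤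
      avg n u y c (Set.Icc (a' : Fin d → ℝ) b) := fun b => neg_le_of_abs_le (abs_avg_le _ _)
  refine (ciInf_le (f := fun b : Set.Icc x (1 : Fin d → ℝ) =>
    avg n u y c (Set.Icc (a' : Fin d → ℝ) b)) ⟨_, by rintro _ ⟨b, rfl⟩; exact hbd b⟩
    ⟨1, hx, le_rfl⟩).trans ?_
  exact (le_abs_self _).trans (abs_avg_le _ _)

end avg

/-! ### Comparing the estimators with grid values of the regression function -/

theorem meshWidth_pos {d n : ℕ} (hM : 0 < gridSize d n) : 0 < meshWidth d n := by
  unfold meshWidth; positivity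

theorem gridSize_mul_meshWidth {d n : ℕ} (hM : 0 < gridSize d n) :
    (gridSize d n : ℝ) * meshWidth d n = 1 := by
  unfold meshWidth; field_simp

theorem natCast_mul_meshWidth_le_one {d n m : ℕ} (hM : 0 < gridSize d n) (hm : m ≤ gridSize d n) :
    (m : ℝ) * meshWidth d n ≤ 1 := by
  rw [← gridSize_mul_meshWidth hM]
  exact mul_le_mul_of_nonneg_right (by exact_mod_cast hm) (meshWidth_pos hM).le

/-- The ratio `r i / h` lies in `[1, M]`, so `J i < 2^(J i) ≤ M`. This crude range suffices because
the sum over scales is bounded uniformly in their number. -/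
theorem exists_dyadic_scale {d n : ℕ} (hM : 0 < gridSize d n) {r : Fin d → ℝ}
    (hr : ∀ i, meshWidth d n ≤ r i) (hr1 : ∀ i, r i ≤ 1) :
    ∃ J : Fin d → ℕ, (∀ i, J i < gridSize d n) ∧ (∀ i, 2 ^ J i * meshWidth d n ≤ r i) ∧
      ∀ i, r i ≤ 2 ^ (J i + 1) * meshWidth d n := by
  have hh := meshWidth_pos hM
  have hJ : ∀ i, ∃ j : ℕ, (2 : ℝ) ^ j ≤ r i / meshWidth d n ∧
      r i / meshWidth d n < 2 ^ (j + 1) := fun i =>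
    exists_nat_pow_near ((one_le_div hh).2 (hr i)) one_lt_two
  choose J h1 h2 using hJ
  have h1' : ∀ i, 2 ^ J i * meshWidth d n ≤ r i := fun i => (le_div_iff₀ hh).1 (h1 i)
  refine ⟨J, fun i => ?_, h1', fun i => ((div_lt_iff₀ hh).1 (h2 i)).le⟩
  have h3 : (2 : ℝ) ^ J i ≤ gridSize d n := by
    refine le_of_mul_le_mul_right ?_ hh
    rw [gridSize_mul_meshWidth hM]
    exact (h1' i).trans (hr1 i)
  exact Nat.lt_two_pow_self.trans_le (by exact_mod_cast h3)

section deterministic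

variable {d n : ℕ} {u : ℕ → Fin d → ℝ} {f : (Fin d → ℝ) → ℝ} {e : ℕ → ℝ} {c L V δ : ℝ}
  {m : Fin d → ℕ} {x : Fin d → ℝ}

/-- A linearized square root: the random quantity `V` enters linearly, so its mean is all that is
needed later. -/
theorem le_add_div_of_sq_le {z : ℝ} (hδ : 0 < δ) (hz : z ^ 2 ≤ V / L ^ 2) :
    |z| ≤ δ + V / L ^ 2 / δ := by
  have h1 : z ^ 2 / δ ≤ V / L ^ 2 / δ := div_le_div_of_nonneg_right hz hδ.le
  have h2 : |z| ≤ δ + z ^ 2 / δ := by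
    rw [← sub_nonneg, ← sq_abs z]
    have : δ + |z| ^ 2 / δ - |z| = ((δ - |z|) ^ 2 + δ * |z|) / δ := by field_simp; ring
    rw [this]
    positivity
  linarith

/-- With `b` a grid point at least one mesh above `x`, any box `[a, b]` with `a ≤ x`, on or off the
grid, contains a grid box of `2^(J i)` cells per side ending at `b`. It is therefore well populated,
and `f ≤ f b` on it. -/
theorem upperEst_le_add (hM : 0 < gridSize d n) (hf : MonotoneOn f (cube d)) (hL0 : 0 < L)
    (hL : ∀ k : Fin d → ℕ, (∀ i, 1 ≤ k i ∧ k i ≤ gridSize d n) → L ≤ count n u (cell d n k))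
    (hm : ∀ i, m i ≤ gridSize d n)
    (hV : ∀ (r : Fin d → ℝ) (J : Fin d → ℕ), (∀ i, J i < gridSize d n) →
      (∀ i, r i ≤ 2 ^ (J i + 1) * meshWidth d n) →
      (∑ t : Fin n, {t : Fin n | u t ∈ signedBox (-1) (fun i => m i * meshWidth d n) r}.indicator
        (fun t : Fin n => e t) t) ^ 2 ≤ V * ∏ i, (4 : ℝ) ^ J i)
    (hδ : 0 < δ) (hx : 0 ≤ x) (hxm : ∀ i, x i + meshWidth d n ≤ m i * meshWidth d n) :
    upperEst n u (fun t => f (u t) + e t) c x ≤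
      f (fun i => m i * meshWidth d n) + (δ + V / L ^ 2 / δ) := by
  have hh := meshWidth_pos hM
  set b : Fin d → ℝ := fun i => m i * meshWidth d n with hb
  have hb1 : b ≤ 1 := fun i => natCast_mul_meshWidth_le_one hM (hm i)
  have hxb : x ≤ b := fun i => by have := hxm i; simp only [hb]; linarith
  refine upperEst_le hx ⟨hxb, hb1⟩ fun a ha => ?_
  obtain ⟨J, hJ, hJ1, hJ2⟩ := exists_dyadic_scale hM (r := b - a)
    (fun i => by have := hxm i; have := ha.2 i; simp only [Pi.sub_apply, hb]; linarith)
    (fun i => by have := hb1 i; have := ha.1 i; simp at *; linarith)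
  have hJm : ∀ i, 2 ^ J i ≤ m i := fun i => by
    have h1 : (2 : ℝ) ^ J i * meshWidth d n ≤ m i * meshWidth d n := by
      have := ha.1 i; have := hJ1 i; simp only [Pi.sub_apply, Pi.zero_apply, hb] at *; linarith
    exact_mod_cast le_of_mul_le_mul_right h1 hh
  have hcount : L * ∏ i, ((2 ^ J i : ℕ) : ℝ) ≤ count n u (Set.Icc a b) := by
    refine mul_prod_le_count hM hL (lo := fun i => m i - 2 ^ J i) (fun i => by
      have := hm i; have := hJm i; omega) (Set.Icc_subset_Icc (fun i => ?_) fun i => ?_)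
    · have := hJ1 i
      simp only [Pi.sub_apply, hb] at this
      rw [Nat.cast_sub (hJm i)]
      push_cast
      linarith
    · rw [Nat.cast_sub (hJm i)]
      simp [hb]
  have hc0 : count n u (Set.Icc a b) ≠ 0 := by
    have : (0 : ℝ) < count n u (Set.Icc a b) := lt_of_lt_of_le (by positivity) hcount
    exact_mod_cast this.ne'
  have hsq := sq_avg_le (c := c) hL0 (by
    rw [← signedBox_neg_one]
    exact hV (b - a) J hJ hJ2) hcount
  have h1 := avg_le_add (c := c) (y := fun t => f (u t) + e t) (e := e) (F := f b) hc0
    fun t ht => by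
      have : f (u t) ≤ f b := hf ⟨ha.1.trans ht.1, ht.2.trans hb1⟩
        ⟨hx.trans hxb, hb1⟩ ht.2
      linarith
  have h2 := (le_abs_self _).trans (le_add_div_of_sq_le hδ hsq)
  linarith

theorem sub_le_lowerEst (hM : 0 < gridSize d n) (hf : MonotoneOn f (cube d)) (hL0 : 0 < L)
    (hL : ∀ k : Fin d → ℕ, (∀ i, 1 ≤ k i ∧ k i ≤ gridSize d n) → L ≤ count n u (cell d n k))
    (hV : ∀ (r : Fin d → ℝ) (J : Fin d → ℕ), (∀ i, J i < gridSize d n) →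
      (∀ i, r i ≤ 2 ^ (J i + 1) * meshWidth d n) →
      (∑ t : Fin n, {t : Fin n | u t ∈ signedBox 1 (fun i => m i * meshWidth d n) r}.indicator
        (fun t : Fin n => e t) t) ^ 2 ≤ V * ∏ i, (4 : ℝ) ^ J i)
    (hδ : 0 < δ) (hx : x ≤ 1) (hxm : ∀ i, m i * meshWidth d n + meshWidth d n ≤ x i) :
    f (fun i => m i * meshWidth d n) - (δ + V / L ^ 2 / δ) ≤
      lowerEst n u (fun t => f (u t) + e t) c x := by
  have hh := meshWidth_pos hM
  set a : Fin d → ℝ := fun i => m i * meshWidth d n with ha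
  have ha0 : 0 ≤ a := fun i => by simp only [ha, Pi.zero_apply]; positivity
  have hax : a ≤ x := fun i => by have := hxm i; simp only [ha]; linarith
  refine le_lowerEst hx ⟨ha0, hax⟩ fun b hb => ?_
  obtain ⟨J, hJ, hJ1, hJ2⟩ := exists_dyadic_scale hM (r := b - a)
    (fun i => by have := hxm i; have := hb.1 i; simp only [Pi.sub_apply, ha]; linarith)
    (fun i => by have := ha0 i; have := hb.2 i; simp at *; linarith)
  have hJm : ∀ i, m i + 2 ^ J i ≤ gridSize d n := fun i => by
    have h1 : ((m i : ℝ) + 2 ^ J i) * meshWidth d n ≤ gridSize d n * meshWidth d n := by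
      rw [gridSize_mul_meshWidth hM]
      have := hb.2 i; have := hJ1 i; simp only [Pi.sub_apply, Pi.one_apply, ha] at *; linarith
    exact_mod_cast le_of_mul_le_mul_right h1 hh
  have hcount : L * ∏ i, ((2 ^ J i : ℕ) : ℝ) ≤ count n u (Set.Icc a b) := by
    refine mul_prod_le_count hM hL hJm (Set.Icc_subset_Icc le_rfl fun i => ?_)
    have := hJ1 i
    simp only [Pi.sub_apply, ha] at this
    push_cast
    linarith
  have hc0 : count n u (Set.Icc a b) ≠ 0 := by
    have : (0 : ℝ) < count n u (Set.Icc a b) := lt_of_lt_of_le (by positivity) hcount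
    exact_mod_cast this.ne'
  have hsq := sq_avg_le (c := c) hL0 (by
    rw [← signedBox_one]
    exact hV (b - a) J hJ hJ2) hcount
  have h1 := add_le_avg (c := c) (y := fun t => f (u t) + e t) (e := e) (F := f a) hc0
    fun t ht => by
      have : f a ≤ f (u t) := hf ⟨ha0, hax.trans hx⟩ ⟨ha0.trans ht.1, ht.2.trans hb.2⟩ ht.1
      linarith
  have h2 := (neg_le_abs _).trans (le_add_div_of_sq_le hδ hsq)
  linarith

end deterministic

/-! ### Bias: the boundary layer and the cover of the interior box -/

/-- Shifting a box of lattice points diagonally changes the sum of a bounded function only by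
the contribution of the boundary layer. -/
theorem sum_shift_sub_le {d K : ℕ} (hK : 3 ≤ K) (G : (Fin d → ℕ) → ℝ) {lo hi : ℝ}
    (hlo : ∀ k, (∀ i, k i < K + 3) → lo ≤ G k) (hhi : ∀ k, (∀ i, k i < K + 3) → G k ≤ hi) :
    ∑ k ∈ Fintype.piFinset fun _ : Fin d => Finset.range K, (G (fun i => k i + 3) - G k) ≤
      ((K : ℝ) ^ d - ((K : ℝ) - 3) ^ d) * (hi - lo) := by
  set S : Finset (Fin d → ℕ) := Fintype.piFinset fun _ : Fin d => Finset.range K with hS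
  set S' : Finset (Fin d → ℕ) := Fintype.piFinset fun _ : Fin d => Finset.Ico 3 (K + 3) with hS'
  set T : Finset (Fin d → ℕ) := Fintype.piFinset fun _ : Fin d => Finset.Ico 3 K with hT
  have hTS : T ⊆ S := Fintype.piFinset_subset _ _ fun _ x hx => by simp at hx ⊢; omega
  have hTS' : T ⊆ S' := Fintype.piFinset_subset _ _ fun _ x hx => by simp at hx ⊢; omega
  have hcS : (S.card : ℝ) = K ^ d := by simp [hS, Fintype.card_piFinset]
  have hcS' : (S'.card : ℝ) = K ^ d := by simp [hS', Fintype.card_piFinset]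
  have hcT : (T.card : ℝ) = ((K : ℝ) - 3) ^ d := by
    simp [hT, Fintype.card_piFinset, Nat.cast_sub hK]
  have hreidx : ∑ k ∈ S, G (fun i => k i + 3) = ∑ k ∈ S', G k := by
    refine Finset.sum_nbij' (fun k i => k i + 3) (fun k i => k i - 3) ?_ ?_ ?_ ?_ ?_
    · intro k hk
      simp only [hS, hS', Fintype.mem_piFinset, Finset.mem_range, Finset.mem_Ico] at hk ⊢
      exact fun i => ⟨by omega, by have := hk i; omega⟩
    · intro k hk
      simp only [hS, hS', Fintype.mem_piFinset, Finset.mem_range, Finset.mem_Ico] at hk ⊢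
      exact fun i => by have := hk i; omega
    · intro k _; ext i; simp
    · intro k hk
      simp only [hS', Fintype.mem_piFinset, Finset.mem_Ico] at hk
      ext i; have := hk i; simp only; omega
    · intro k _; rfl
  -- The overlap `T` of the box and its shift cancels; each remainder has `K^d - (K-3)^d` points.
  rw [Finset.sum_sub_distrib, hreidx, ← Finset.sum_sdiff hTS, ← Finset.sum_sdiff hTS']
  have h1 : ∑ k ∈ S' \ T, G k ≤ ((K : ℝ) ^ d - ((K : ℝ) - 3) ^ d) * hi := by
    rw [← hcS', ← hcT, ← Finset.cast_card_sdiff hTS', ← nsmul_eq_mul, ← Finset.sum_const]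
    refine Finset.sum_le_sum fun k hk => hhi k fun i => ?_
    have := Fintype.mem_piFinset.1 (Finset.mem_sdiff.1 hk).1 i
    exact (Finset.mem_Ico.1 this).2
  have h2 : ((K : ℝ) ^ d - ((K : ℝ) - 3) ^ d) * lo ≤ ∑ k ∈ S \ T, G k := by
    rw [← hcS, ← hcT, ← Finset.cast_card_sdiff hTS, ← nsmul_eq_mul, ← Finset.sum_const]
    refine Finset.sum_le_sum fun k hk => hlo k fun i => ?_
    have := Fintype.mem_piFinset.1 (Finset.mem_sdiff.1 hk).1 i
    have := Finset.mem_range.1 this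
    omega
  linarith

theorem interiorBox_subset {d n : ℕ} (hM : 2 < gridSize d n) :
    interiorBox d n ⊆ ⋃ k ∈ Fintype.piFinset fun _ : Fin d => Finset.range (gridSize d n - 2),
      Set.Icc (fun i => ((k i : ℝ) + 1) * meshWidth d n)
        (fun i => ((k i : ℝ) + 2) * meshWidth d n) := by
  intro x hx
  have hM0 : 0 < gridSize d n := by omega
  have hh := meshWidth_pos hM0
  have h1 : ∀ i, 1 ≤ x i / meshWidth d n := fun i => (one_le_div hh).2 (hx.1 i)
  have h2 : ∀ i, x i / meshWidth d n ≤ (gridSize d n - 1 : ℕ) := fun i => by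
    rw [div_le_iff₀ hh, Nat.cast_sub (by omega), sub_mul, gridSize_mul_meshWidth hM0]
    simpa using hx.2 i
  simp only [Set.mem_iUnion]
  -- Truncated subtraction matters when `x i = h`: the ceiling is `1`, and index `0` is still
  -- correct because the cells are closed.
  refine ⟨fun i => ⌈x i / meshWidth d n⌉₊ - 2, ?_, fun i => ?_, fun i => ?_⟩
  · rw [Fintype.mem_piFinset]
    intro i
    have := Nat.ceil_le.2 (h2 i)
    rw [Finset.mem_range]
    omega
  · rw [← le_div_iff₀ hh]
    change ((⌈x i / meshWidth d n⌉₊ - 2 : ℕ) : ℝ) + 1 ≤ _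
    by_cases hc : ⌈x i / meshWidth d n⌉₊ < 2
    · rw [Nat.sub_eq_zero_of_le hc.le]; simpa using h1 i
    · have h3 := Nat.ceil_lt_add_one (zero_le_one.trans (h1 i))
      rw [Nat.cast_sub (not_lt.1 hc)]
      push_cast
      linarith
  · rw [← div_le_iff₀ hh]
    refine (Nat.le_ceil _).trans ?_
    have : ⌈x i / meshWidth d n⌉₊ ≤ ⌈x i / meshWidth d n⌉₊ - 2 + 2 := by omega
    exact_mod_cast this

/-! ### Moments of the errors over design events -/

section errors

variable {Ω : Type*} [MeasurableSpace Ω] {P : Measure Ω}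

/-- Set integrals over design events are the only form in which the conditional mean enters the
maximal inequalities. -/
theorem setIntegral_preimage_eq_zero [IsFiniteMeasure P] {D : Type*} [MeasurableSpace D] {X : Ω → D} {e : Ω → ℝ}
    (hX : Measurable X) (he : Integrable e P)
    (hmean : P[e | MeasurableSpace.comap X inferInstance] =ᵐ[P] 0) {B : Set D}
    (hB : MeasurableSet B) : ∫ ω in X ⁻¹' B, e ω ∂P = 0 := by
  rw [← setIntegral_condExp hX.comap_le he ⟨B, hB, rfl⟩]
  rw [setIntegral_congr_ae (g := fun _ => 0) (hX hB) (hmean.mono fun ω h _ => h)]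
  simp

theorem setIntegral_preimage_sq_le [IsProbabilityMeasure P] {D : Type*} [MeasurableSpace D] {X : Ω → D} {e : Ω → ℝ}
    {σ : ℝ} (hX : Measurable X) (he : MemLp e 2 P)
    (hvar : P[fun ω => e ω ^ 2 | MeasurableSpace.comap X inferInstance] ≤ᵐ[P] fun _ => σ ^ 2)
    {B : Set D} (hB : MeasurableSet B) :
    ∫ ω in X ⁻¹' B, e ω ^ 2 ∂P ≤ σ ^ 2 * P.real (X ⁻¹' B) := by
  rw [← setIntegral_condExp hX.comap_le he.integrable_sq ⟨B, hB, rfl⟩]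
  refine (setIntegral_mono_ae integrable_condExp.integrableOn (integrable_const _).integrableOn
    hvar).trans_eq ?_
  simp [mul_comm]

theorem measureReal_preimage_Icc_le {d : ℕ} {X : Ω → Fin d → ℝ} (hX : Measurable X)
    {p : (Fin d → ℝ) → ℝ} {C₂ : ℝ} (hC₂ : 0 ≤ C₂) (hp : ∀ x ∈ cube d, p x ≤ C₂)
    (hdens : P.map X =
      (volume.restrict (cube d)).withDensity (fun x => ENNReal.ofReal (p x)))
    {a b : Fin d → ℝ} (hab : a ≤ b) :
    P.real (X ⁻¹' Set.Icc a b) ≤ C₂ * ∏ i, (b i - a i) := by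
  have hprod : 0 ≤ ∏ i, (b i - a i) := Finset.prod_nonneg fun i _ => sub_nonneg.2 (hab i)
  refine ENNReal.toReal_le_of_le_ofReal (mul_nonneg hC₂ hprod) ?_
  rw [← Measure.map_apply hX measurableSet_Icc, hdens, withDensity_apply _ measurableSet_Icc,
    Measure.restrict_restrict measurableSet_Icc]
  calc ∫⁻ x in Set.Icc a b ∩ cube d, ENNReal.ofReal (p x)
      ≤ ∫⁻ _x in Set.Icc a b ∩ cube d, ENNReal.ofReal C₂ :=
        setLIntegral_mono' (measurableSet_Icc.inter measurableSet_Icc) fun x hx =>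
          ENNReal.ofReal_le_ofReal (hp x hx.2)
    _ ≤ ∫⁻ _x in Set.Icc a b, ENNReal.ofReal C₂ := lintegral_mono_set Set.inter_subset_left
    _ = ENNReal.ofReal (C₂ * ∏ i, (b i - a i)) := by
        rw [setLIntegral_const, Real.volume_Icc_pi, ENNReal.ofReal_mul hC₂,
          ENNReal.ofReal_prod_of_nonneg fun i _ => sub_nonneg.2 (hab i)]

end errors

/-! ### The finite-sample bound and its rate -/

/-- A finite-sample bound for the expected `L¹` loss on the event that all cells are
sufficiently occupied. -/
theorem lintegral_regularEvent_le {Ω : Type*} [MeasurableSpace Ω] {P : Measure Ω}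
    [IsProbabilityMeasure P] {d n : ℕ} {f : (Fin d → ℝ) → ℝ} (hf : MonotoneOn f (cube d))
    {I : ℕ → Ω → Fin d → ℝ} {ε : ℕ → Ω → ℝ}
    (hI : ∀ t, Measurable (I t)) (hε : ∀ t, Measurable (ε t))
    (hindep : iIndepFun (fun t ω => (I t ω, ε t ω)) P) (hL2 : ∀ t, MemLp (ε t) 2 P)
    (hmean : ∀ t, ∀ B : Set (Fin d → ℝ), MeasurableSet B → ∫ ω in I t ⁻¹' B, ε t ω ∂P = 0)
    {K₀ : ℝ} (hK₀ : 0 ≤ K₀)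
    (hvar : ∀ t, ∀ a b : Fin d → ℝ, a ≤ b →
      ∫ ω in I t ⁻¹' Set.Icc a b, ε t ω ^ 2 ∂P ≤ K₀ * ∏ i, (b i - a i))
    {c C₁ δ L : ℝ} (hL : L = C₁ / 2 * (n : ℝ) ^ ((2 : ℝ) / ((d : ℝ) + 2))) (hL0 : 0 < L)
    (hδ : 0 < δ) (hM : 5 ≤ gridSize d n) {fhat : Ω → (Fin d → ℝ) → ℝ}
    (hlower : ∀ ω, ∀ x ∈ cube d,
      lowerEst n (fun t => I t ω) (fun t => f (I t ω) + ε t ω) c x ≤ fhat ω x)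
    (hupper : ∀ ω, ∀ x ∈ cube d,
      fhat ω x ≤ upperEst n (fun t => I t ω) (fun t => f (I t ω) + ε t ω) c x) :
    ∫⁻ ω, (regularEvent I C₁ n).indicator
        (fun ω => ∫⁻ x in interiorBox d n, ENNReal.ofReal |fhat ω x - f x|) ω ∂P ≤
      ENNReal.ofReal (meshWidth d n ^ d * (((gridSize d n : ℝ) - 2) ^ d -
          ((gridSize d n : ℝ) - 5) ^ d) * (f 1 - f 0) +
        (δ + 2 * (16 ^ d * (n * K₀) * meshWidth d n ^ d) / L ^ 2 / δ)) := by
  have hM0 : 0 < gridSize d n := by omega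
  have hh := meshWidth_pos hM0
  set h := meshWidth d n
  set M := gridSize d n
  have hindep' : iIndepFun (fun (t : Fin n) ω => (I t ω, ε t ω)) P :=
    hindep.precomp Fin.val_injective
  -- `Vm` controls boxes ending at `(k+3)h`, and `Vp` boxes starting at `kh`. Offset `3` leaves one
  -- mesh of room on either side of the cell `Q k`.
  have hVm : ∀ (k : Fin d → ℕ), _ := fun k =>
    exists_signedBox_majorant (X := fun t : Fin n => I t) (e := fun t : Fin n => ε t)
      (fun t => hI t) (fun t => hε t) hindep' (fun t => hmean t) (fun t => hL2 t) (-1)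
      (fun i => ((k i + 3 : ℕ) : ℝ) * h) (K := K₀) hh.le (fun t r hr => by
        have := hvar t ((fun i => ((k i + 3 : ℕ) : ℝ) * h) - r) _
          (sub_le_self _ (Pi.le_def.2 hr))
        rw [← signedBox_neg_one] at this
        simpa using this) hK₀ M
  have hVp : ∀ (k : Fin d → ℕ), _ := fun k =>
    exists_signedBox_majorant (X := fun t : Fin n => I t) (e := fun t : Fin n => ε t)
      (fun t => hI t) (fun t => hε t) hindep' (fun t => hmean t) (fun t => hL2 t) 1
      (fun i => (k i : ℝ) * h) (K := K₀) hh.le (fun t r hr => by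
        have := hvar t _ ((fun i => (k i : ℝ) * h) + r)
          (le_add_of_nonneg_right (Pi.le_def.2 hr))
        rw [← signedBox_one] at this
        simpa using this) hK₀ M
  choose Vm hVm_int hVm0 hVm_le hVm_E using hVm
  choose Vp hVp_int hVp0 hVp_le hVp_E using hVp
  set S : Finset (Fin d → ℕ) := Fintype.piFinset fun _ : Fin d => Finset.range (M - 2) with hS
  set G : (Fin d → ℕ) → ℝ := fun k => f fun i => (k i : ℝ) * h with hG
  set Q : (Fin d → ℕ) → Set (Fin d → ℝ) := fun k =>
    Set.Icc (fun i => ((k i : ℝ) + 1) * h) (fun i => ((k i : ℝ) + 2) * h) with hQ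
  have hcube : ∀ k : Fin d → ℕ, (∀ i, k i ≤ M) → (fun i => (k i : ℝ) * h) ∈ cube d := fun k hk =>
    ⟨fun i => by simp only [Pi.zero_apply]; positivity,
      fun i => natCast_mul_meshWidth_le_one hM0 (hk i)⟩
  have hSlt : ∀ k ∈ S, ∀ i, k i + 3 ≤ M := fun k hk i => by
    have := Finset.mem_range.1 (Fintype.mem_piFinset.1 hk i)
    omega
  set R : (Fin d → ℕ) → Ω → ℝ := fun k ω =>
    G (fun i => k i + 3) - G k + (δ + (Vm k ω + Vp k ω) / L ^ 2 / δ) with hR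
  have hRint : ∀ k, Integrable (R k) P := fun k =>
    (integrable_const _).add ((integrable_const _).add
      ((((hVm_int k).add (hVp_int k)).div_const _).div_const _))
  have hGmono : ∀ k ∈ S, G k ≤ G fun i => k i + 3 := fun k hk =>
    hf (hcube k fun i => by have := hSlt k hk i; omega) (hcube _ fun i => hSlt k hk i) fun i =>
      mul_le_mul_of_nonneg_right (by push_cast; linarith) hh.le
  have hR0 : ∀ k ∈ S, ∀ ω, 0 ≤ R k ω := fun k hk ω => by
    have := hGmono k hk
    have := hVm0 k ω
    have := hVp0 k ω
    have : 0 ≤ (Vm k ω + Vp k ω) / L ^ 2 / δ := by positivity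
    simp only [hR]
    linarith
  have hpoint : ∀ k ∈ S, ∀ ω ∈ regularEvent I C₁ n, ∀ x ∈ Q k, |fhat ω x - f x| ≤ R k ω := by
    intro k hk ω hω x hx
    have hω' : ∀ k : Fin d → ℕ, (∀ i, 1 ≤ k i ∧ k i ≤ M) →
        L ≤ count n (fun t => I t ω) (cell d n k) := fun k hk => hL ▸ hω k hk
    have hxa : ∀ i, (k i : ℝ) * h + h ≤ x i := fun i => by
      have := hx.1 i; simp only at this; linarith
    have hxb : ∀ i, x i + h ≤ ((k i + 3 : ℕ) : ℝ) * h := fun i => by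
      have := hx.2 i; simp only at this; push_cast; linarith
    have hca := hcube k fun i => by have := hSlt k hk i; omega
    have hcb := hcube (fun i => k i + 3) fun i => hSlt k hk i
    have hax : (fun i => (k i : ℝ) * h) ≤ x := fun i => by
      have := hxa i; simp only; linarith
    have hbx : x ≤ fun i => ((k i + 3 : ℕ) : ℝ) * h := fun i => by
      have := hxb i; simp only; linarith
    have hxc : x ∈ cube d := ⟨hca.1.trans hax, hbx.trans hcb.2⟩
    have hup := (hupper ω x hxc).trans (upperEst_le_add hM0 hf hL0 hω' (fun i => hSlt k hk i)
      (hVm_le k ω)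
      hδ hxc.1 hxb)
    have hlow := (sub_le_lowerEst hM0 hf hL0 hω'
      (hVp_le k ω)
      hδ hxc.2 hxa).trans (hlower ω x hxc)
    have h1 : G k ≤ f x := hf hca hxc hax
    have h2 : f x ≤ G fun i => k i + 3 := hf hxc hcb hbx
    have h3 : 0 ≤ Vm k ω / L ^ 2 / δ := by have := hVm0 k ω; positivity
    have h4 : 0 ≤ Vp k ω / L ^ 2 / δ := by have := hVp0 k ω; positivity
    simp only [hR, add_div]
    rw [abs_le]
    constructor
    · change G k - _ ≤ _ at hlow; linarith
    · change _ ≤ G (fun i => k i + 3) + _ at hup; linarith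
  have hvol : ∀ k, volume (Q k) = ENNReal.ofReal (h ^ d) := fun k => by
    rw [hQ, Real.volume_Icc_pi, ← ENNReal.ofReal_prod_of_nonneg fun i _ => by
      have : ((k i : ℝ) + 1) * h ≤ ((k i : ℝ) + 2) * h :=
        mul_le_mul_of_nonneg_right (by linarith) hh.le
      linarith]
    congr 1
    rw [Finset.prod_congr rfl fun i _ => show ((k i : ℝ) + 2) * h - ((k i : ℝ) + 1) * h = h by ring]
    simp
  calc ∫⁻ ω, (regularEvent I C₁ n).indicator
        (fun ω => ∫⁻ x in interiorBox d n, ENNReal.ofReal |fhat ω x - f x|) ω ∂P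
      ≤ ∫⁻ ω, ENNReal.ofReal (∑ k ∈ S, R k ω * h ^ d) ∂P := by
        refine lintegral_mono fun ω => ?_
        by_cases hω : ω ∈ regularEvent I C₁ n
        swap
        · simp [hω]
        rw [Set.indicator_of_mem hω]
        have hcover : interiorBox d n ⊆ ⋃ k : S, Q k := fun x hx => by
          obtain ⟨k, hk, hxk⟩ := Set.mem_iUnion₂.1 (interiorBox_subset (by omega) hx)
          exact Set.mem_iUnion.2 ⟨⟨k, hk⟩, hxk⟩
        refine (lintegral_mono_set hcover).trans ?_
        refine (lintegral_iUnion_le _ _).trans ?_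
        rw [tsum_fintype, ENNReal.ofReal_sum_of_nonneg fun k hk =>
          mul_nonneg (hR0 k hk ω) (by positivity), 
          ← Finset.sum_coe_sort S fun k => ENNReal.ofReal (R k ω * h ^ d)]
        refine Finset.sum_le_sum fun k _ => ?_
        refine (setLIntegral_mono' (g := fun _ => ENNReal.ofReal (R k ω)) measurableSet_Icc
          fun x hx => ENNReal.ofReal_le_ofReal (hpoint k k.2 ω hω x hx)).trans_eq ?_
        rw [setLIntegral_const, ENNReal.ofReal_mul (hR0 k k.2 ω)]
        exact congrArg _ (hvol k)
    _ = ENNReal.ofReal (∑ k ∈ S, (∫ ω, R k ω ∂P) * h ^ d) := by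
        rw [← ofReal_integral_eq_lintegral_ofReal
          (integrable_finsetSum _ fun k _ => (hRint k).mul_const _)
          (.of_forall fun ω => Finset.sum_nonneg fun k hk =>
            mul_nonneg (hR0 k hk ω) (by positivity)),
          integral_finsetSum _ fun k _ => (hRint k).mul_const _]
        simp only [integral_mul_const]
    _ ≤ _ := by
        refine ENNReal.ofReal_le_ofReal ?_
        set B := 16 ^ d * (n * K₀) * h ^ d with hB
        have hB0 : 0 ≤ B := by positivity
        have hER : ∀ k, ∫ ω, R k ω ∂P ≤
            G (fun i => k i + 3) - G k + (δ + 2 * B / L ^ 2 / δ) := by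
          intro k
          have hU : Integrable (fun ω => (Vm k ω + Vp k ω) / L ^ 2 / δ) P :=
            (((hVm_int k).add (hVp_int k)).div_const _).div_const _
          have hRU : R k = fun ω => (G (fun i => k i + 3) - G k + δ) +
              (Vm k ω + Vp k ω) / L ^ 2 / δ := by
            ext ω; simp only [hR]; ring
          rw [hRU, integral_add (integrable_const _) hU, integral_div, integral_div,
            integral_add (hVm_int k) (hVp_int k), integral_const, probReal_univ, one_smul]
          have : (∫ ω, Vm k ω ∂P + ∫ ω, Vp k ω ∂P) / L ^ 2 / δ ≤ 2 * B / L ^ 2 / δ := by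
            have := hVm_E k
            have := hVp_E k
            gcongr
            linarith
          linarith
        have hcard : (S.card : ℝ) = ((M : ℝ) - 2) ^ d := by
          simp [hS, Fintype.card_piFinset, Nat.cast_sub (show 2 ≤ M by omega)]
        -- Indices below `(M - 2) + 3` are exactly the grid indices `0, …, M`, where `f` lies
        -- between `f 0` and `f 1`; `5 ≤ M` ensures a shift by `3` fits.
        have hG1 := sum_shift_sub_le (K := M - 2) (by omega) G (lo := f 0) (hi := f 1)
          (fun k hk => hf ⟨le_rfl, zero_le_one⟩ (hcube k fun i => by have := hk i; omega)
            (hcube k fun i => by have := hk i; omega).1)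
          (fun k hk => hf (hcube k fun i => by have := hk i; omega) ⟨zero_le_one, le_rfl⟩
            (hcube k fun i => by have := hk i; omega).2)
        rw [Nat.cast_sub (by omega)] at hG1
        have hvol1 : ((M : ℝ) - 2) ^ d * h ^ d ≤ 1 := by
          have hM2 : (0 : ℝ) ≤ (M : ℝ) - 2 := by
            have : (5 : ℝ) ≤ M := by exact_mod_cast hM
            linarith
          rw [← mul_pow]
          refine pow_le_one₀ (by positivity) ?_
          have := gridSize_mul_meshWidth hM0
          nlinarith
        calc ∑ k ∈ S, (∫ ω, R k ω ∂P) * h ^ d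
            ≤ ∑ k ∈ S, (G (fun i => k i + 3) - G k + (δ + 2 * B / L ^ 2 / δ)) * h ^ d :=
              Finset.sum_le_sum fun k _ => mul_le_mul_of_nonneg_right (hER k) (by positivity)
          _ = (∑ k ∈ S, (G (fun i => k i + 3) - G k)) * h ^ d +
                (((M : ℝ) - 2) ^ d * h ^ d) * (δ + 2 * B / L ^ 2 / δ) := by
              rw [← Finset.sum_mul, Finset.sum_add_distrib, Finset.sum_const, nsmul_eq_mul, hcard]
              ring
          _ ≤ (((M : ℝ) - 2) ^ d - ((M : ℝ) - 5) ^ d) * (f 1 - f 0) * h ^ d +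
                1 * (δ + 2 * B / L ^ 2 / δ) := by
              have e1 : (M : ℝ) - 5 = M - (2 : ℕ) - 3 := by push_cast; ring
              rw [e1]
              refine add_le_add (mul_le_mul_of_nonneg_right ?_ (by positivity))
                (mul_le_mul_of_nonneg_right hvol1 (by positivity))
              exact_mod_cast hG1
          _ = _ := by ring

/-- The finite-sample bound is of the order `n^{-1/(d+2)}`. -/
theorem rate_bound {d n : ℕ} {C₁ K₀ D : ℝ} (hC₁ : 0 < C₁) (hK₀ : 0 ≤ K₀) (hD : 0 ≤ D) {x : ℝ}
    (hx : 5 ≤ x) (hxn : x ^ (d + 2) = n) {M : ℕ} (hM : M = ⌊x⌋₊) :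
    (1 / (M : ℝ)) ^ d * (((M : ℝ) - 2) ^ d - ((M : ℝ) - 5) ^ d) * D +
        (x⁻¹ + 2 * (16 ^ d * (n * K₀) * (1 / (M : ℝ)) ^ d) / (C₁ / 2 * x ^ 2) ^ 2 / x⁻¹) ≤
      (12 * d * D + 1 + 8 * 32 ^ d * K₀ / C₁ ^ 2) * x⁻¹ := by
  have hx0 : 0 < x := by linarith
  have hM5 : (5 : ℝ) ≤ M := by
    rw [hM]; exact_mod_cast Nat.le_floor (by exact_mod_cast hx)
  have hMx : x / 2 ≤ M := by
    have := Nat.lt_floor_add_one x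
    rw [← hM] at this
    linarith
  have hM0 : (0 : ℝ) < M := by linarith
  have hK : (0 : ℝ) < M - 2 := by linarith
  have h1 : (1 / (M : ℝ)) ^ d * (((M : ℝ) - 2) ^ d - ((M : ℝ) - 5) ^ d) ≤ 12 * d * x⁻¹ := by
    -- Bernoulli's inequality shows that the boundary layer is a fraction at most `3d / (M - 2)` of
    -- the lattice box.
    have hbern : 1 + (d : ℝ) * (-3 / ((M : ℝ) - 2)) ≤ (1 + -3 / ((M : ℝ) - 2)) ^ d := by
      refine one_add_mul_le_pow ?_ d
      rw [le_div_iff₀ hK]; linarith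
    have hsplit : ((M : ℝ) - 5) ^ d = ((M : ℝ) - 2) ^ d * (1 + -3 / ((M : ℝ) - 2)) ^ d := by
      rw [← mul_pow]; congr 1; field_simp; ring
    have hratio : (1 / (M : ℝ)) ^ d * ((M : ℝ) - 2) ^ d ≤ 1 := by
      rw [← mul_pow]
      refine pow_le_one₀ (by positivity) ?_
      rw [one_div_mul_eq_div, div_le_one hM0]; linarith
    have hfrac : (d : ℝ) * (3 / ((M : ℝ) - 2)) ≤ 12 * d * x⁻¹ := by
      -- The constant `12` comes from `x ≤ 2M ≤ 4(M - 2)`.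
      have : 3 / ((M : ℝ) - 2) ≤ 12 * x⁻¹ := by
        rw [← div_eq_mul_inv, div_le_div_iff₀ hK hx0]; linarith
      calc (d : ℝ) * (3 / ((M : ℝ) - 2)) ≤ d * (12 * x⁻¹) :=
            mul_le_mul_of_nonneg_left this (by positivity)
        _ = _ := by ring
    rw [hsplit]
    calc (1 / (M : ℝ)) ^ d * (((M : ℝ) - 2) ^ d -
          ((M : ℝ) - 2) ^ d * (1 + -3 / ((M : ℝ) - 2)) ^ d)
        = (1 / (M : ℝ)) ^ d * ((M : ℝ) - 2) ^ d * (1 - (1 + -3 / ((M : ℝ) - 2)) ^ d) := by ring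
      _ ≤ (1 / (M : ℝ)) ^ d * ((M : ℝ) - 2) ^ d * ((d : ℝ) * (3 / ((M : ℝ) - 2))) := by
          refine mul_le_mul_of_nonneg_left ?_ (by positivity)
          rw [neg_div] at hbern ⊢
          linarith
      _ ≤ 1 * ((d : ℝ) * (3 / ((M : ℝ) - 2))) :=
          mul_le_mul_of_nonneg_right hratio (by positivity)
      _ ≤ _ := by rw [one_mul]; exact hfrac
  have h2 : 2 * (16 ^ d * (n * K₀) * (1 / (M : ℝ)) ^ d) / (C₁ / 2 * x ^ 2) ^ 2 / x⁻¹ ≤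
      8 * 32 ^ d * K₀ / C₁ ^ 2 * x⁻¹ := by
    have hmesh : x ^ d * (1 / (M : ℝ)) ^ d ≤ 2 ^ d := by
      rw [← mul_pow]
      refine pow_le_pow_left₀ (by positivity) ?_ d
      rw [mul_one_div, div_le_iff₀ hM0]; linarith
    rw [← hxn]
    -- Power count: `x^(d+2) · x^(-4) · x = x^(-1) · x^d`, and `x^d` pairs with `M^(-d)` at the cost
    -- of `2^d`.
    calc 2 * (16 ^ d * (x ^ (d + 2) * K₀) * (1 / (M : ℝ)) ^ d) / (C₁ / 2 * x ^ 2) ^ 2 / x⁻¹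
        = 8 * 16 ^ d * K₀ / C₁ ^ 2 * x⁻¹ * (x ^ d * (1 / (M : ℝ)) ^ d) := by
          field_simp; ring
      _ ≤ 8 * 16 ^ d * K₀ / C₁ ^ 2 * x⁻¹ * 2 ^ d :=
          mul_le_mul_of_nonneg_left hmesh (by positivity)
      _ = 8 * 32 ^ d * K₀ / C₁ ^ 2 * x⁻¹ := by
          rw [show (32 : ℝ) = 16 * 2 by norm_num, mul_pow]; ring
  have h3 := mul_le_mul_of_nonneg_right h1 hD
  linarith

end IsoReg

theorem theorem2p1 {Ω : Type*} [MeasurableSpace Ω] (P : Measure Ω) [IsProbabilityMeasure P]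
    (d : ℕ) (hd : 1 ≤ d)
    -- the isotonic regression function on the unit cube
    (f : (Fin d → ℝ) → ℝ) (hf : MonotoneOn f (IsoReg.cube d))
    -- the i.i.d. pairs of covariates and errors
    (I : ℕ → Ω → Fin d → ℝ) (ε : ℕ → Ω → ℝ)
    (hI : ∀ t, Measurable (I t)) (hε : ∀ t, Measurable (ε t))
    (hindep : iIndepFun (fun t ω => (I t ω, ε t ω)) P)
    (hident : ∀ t, IdentDistrib (fun ω => (I t ω, ε t ω)) (fun ω => (I 0 ω, ε 0 ω)) P P)
    -- the covariates have a density on the cube with infimum `C₁ > 0` and supremum `C₂ < ∞`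
    (p : (Fin d → ℝ) → ℝ) (hp : Measurable p) (C₁ C₂ : ℝ) (hC₁ : 0 < C₁)
    (hp_inf : IsGLB (p '' IsoReg.cube d) C₁) (hp_sup : IsLUB (p '' IsoReg.cube d) C₂)
    (hdens : ∀ t, P.map (I t) =
      (volume.restrict (IsoReg.cube d)).withDensity (fun x => ENNReal.ofReal (p x)))
    -- zero conditional mean and bounded conditional variance of the errors
    -- (square integrability makes the conditional expectations meaningful)
    (σ : ℝ) (hL2 : ∀ t, MemLp (ε t) 2 P)
    (hmean : ∀ t, P[ε t | MeasurableSpace.comap (I t) inferInstance] =ᵐ[P] 0)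
    (hvar : ∀ t, P[fun ω => ε t ω ^ 2 | MeasurableSpace.comap (I t) inferInstance]
      ≤ᵐ[P] fun _ => σ ^ 2)
    -- any value assigned to averages over rectangles without observations
    (c : ℝ)
    -- any isotonic estimator between the max–min and the min–max estimator
    (fhat : ℕ → Ω → (Fin d → ℝ) → ℝ)
    (hfhat_meas : ∀ n, ∀ x ∈ IsoReg.cube d, AEMeasurable (fun ω => fhat n ω x) P)
    (hfhat_mono : ∀ n ω, MonotoneOn (fhat n ω) (IsoReg.cube d))
    (hfhat_lower : ∀ n ω, ∀ x ∈ IsoReg.cube d,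
      IsoReg.lowerEst n (fun t => I t ω) (fun t => f (I t ω) + ε t ω) c x ≤ fhat n ω x)
    (hfhat_upper : ∀ n ω, ∀ x ∈ IsoReg.cube d,
      fhat n ω x ≤ IsoReg.upperEst n (fun t => I t ω) (fun t => f (I t ω) + ε t ω) c x) :
    ∃ C : ℝ≥0, ∀ᶠ n : ℕ in atTop,
      ∫⁻ ω, (IsoReg.regularEvent I C₁ n).indicator
          (fun ω => ∫⁻ x in IsoReg.interiorBox d n, ENNReal.ofReal |fhat n ω x - f x|) ω ∂P
        ≤ (C : ℝ≥0∞) * ENNReal.ofReal ((n : ℝ) ^ (-(1 : ℝ) / ((d : ℝ) + 2))) := by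
  have hcube0 : (0 : Fin d → ℝ) ∈ IsoReg.cube d := ⟨le_rfl, zero_le_one⟩
  have hC₂ : 0 ≤ C₂ :=
    hC₁.le.trans ((hp_inf.1 ⟨0, hcube0, rfl⟩).trans (hp_sup.1 ⟨0, hcube0, rfl⟩))
  have hD : 0 ≤ f 1 - f 0 :=
    sub_nonneg.2 (hf hcube0 ⟨zero_le_one, le_rfl⟩ zero_le_one)
  have hd2 : (0 : ℝ) < (d : ℝ) + 2 := by positivity
  refine ⟨Real.toNNReal (12 * d * (f 1 - f 0) + 1 + 8 * 32 ^ d * (σ ^ 2 * C₂) / C₁ ^ 2), ?_⟩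
  have htend : Tendsto (fun n : ℕ => (n : ℝ) ^ ((1 : ℝ) / ((d : ℝ) + 2))) atTop atTop :=
    (tendsto_rpow_atTop (by positivity)).comp tendsto_natCast_atTop_atTop
  filter_upwards [htend.eventually_ge_atTop 5] with n hn
  set x : ℝ := (n : ℝ) ^ ((1 : ℝ) / ((d : ℝ) + 2)) with hx
  have hx0 : 0 < x := by linarith
  have hn0 : (0 : ℝ) ≤ n := n.cast_nonneg
  have hx2 : (n : ℝ) ^ ((2 : ℝ) / ((d : ℝ) + 2)) = x ^ 2 := by
    rw [hx, ← Real.rpow_natCast, ← Real.rpow_mul hn0]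
    congr 1; push_cast; ring
  have hxn : x ^ (d + 2) = n := by
    rw [hx, ← Real.rpow_natCast, ← Real.rpow_mul hn0]
    push_cast
    rw [one_div, inv_mul_cancel₀ hd2.ne', Real.rpow_one]
  have hxinv : (n : ℝ) ^ (-(1 : ℝ) / ((d : ℝ) + 2)) = x⁻¹ := by
    rw [neg_div, Real.rpow_neg hn0]
  have hM : 5 ≤ IsoReg.gridSize d n := Nat.le_floor (show ((5 : ℕ) : ℝ) ≤ x by simpa using hn)
  have hint : ∀ t, Integrable (ε t) P := fun t => (hL2 t).integrable one_le_two
  have hbound := IsoReg.lintegral_regularEvent_le (n := n) (C₁ := C₁) (c := c) hf hI hε hindep hL2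
    (fun t B hB => IsoReg.setIntegral_preimage_eq_zero (hI t) (hint t) (hmean t) hB)
    (K₀ := σ ^ 2 * C₂) (by positivity)
    (fun t a b hab => by
      refine (IsoReg.setIntegral_preimage_sq_le (hI t) (hL2 t) (hvar t)
        measurableSet_Icc).trans ?_
      rw [mul_assoc]
      exact mul_le_mul_of_nonneg_left (IsoReg.measureReal_preimage_Icc_le (hI t) hC₂
        (fun y hy => hp_sup.1 ⟨y, hy, rfl⟩) (hdens t) hab) (sq_nonneg σ))
    -- Here `δ = x⁻¹`, the target rate, which gives `δ` and the second-moment term the same order.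
    rfl (by rw [hx2]; positivity) (inv_pos.2 hx0) hM (hfhat_lower n) (hfhat_upper n)
  refine hbound.trans ?_
  rw [hxinv, hx2, ← ENNReal.ofReal, ← ENNReal.ofReal_mul (by positivity)]
  exact ENNReal.ofReal_le_ofReal
    (IsoReg.rate_bound hC₁ (by positivity) hD hn hxn rfl)
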